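/- Throughout, $(\Omega,\mu)$ is an atomless Lebesgue space (an atomless Borel probability measure on a Polish space, e.g. $[0,1]$ with Lebesgue measure). For a bounded Polish (i.e. complete separable) metric space $(X,d)$, let $X^\Omega=L^0(\Omega,X)$ be the set of $X$-valued random variables up to almost sure equality, with the metric $d^\Omega(r,s)=\int_\Omega d(r(\omega),s(\omega))\,d\mu(\omega)$. For a Polish space $Y$, the space $Y^\Omega$ carries the topology induced by any compatible bounded metric on $Y$ (the choice does not matter). Let $\mathrm{Aut}(\Omega)$ be the group of invertible measure-preserving transformations of $\Omega$ up to almost sure equality, acting by $(tr)(\omega)=r(t^{-1}(\omega))$, with the topology of pointwise convergence on $[0,1]^\Omega$. For a Polish group $G$, the measurable wreath product is $G\wr\Omega=G^\Omega\rtimes\mathrm{Aut}(\Omega)$ with the product topology, where $G^\Omega$ has pointwise multiplication. If $G$ acts continuously by isometries on $(X,d)$, then $G\wr\Omega$ acts by isometries on $(X^\Omega,d^\Omega)$ by $((g,t)r)(\omega)=g(\omega)\,r(t^{-1}(\omega))$. For an action by isometries $G\curvearrowright(X,d)$, the metric quotient $X/\!/G$ is the set of orbit closures $\overline{Gx}$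 with the metric $d(\overline{Gx},\overline{Gy})=\inf_{g\in G}d(x,gy)$. The action is approximately oligomorphic if $X^n/\!/G$ is compact for every $n\in\mathbb N$, where $G$ acts diagonally on $X^n$ with the supremum metric. It is faithful if the induced homomorphism $G\to\mathrm{Iso}(X)$ is a topological embedding, where $\mathrm{Iso}(X)$ has the topology of pointwise convergence. A Polish group is Roelcke precompact if it admits a faithful approximately oligomorphic action on some Polish metric space. Let $G$ be a Polish group. Then $G\wr\Omega$ is a Polish group, and the following hold. 1. If $G$ acts continuously by isometries on a bounded Polish metric space $(X,d)$ and the action is approximately oligomorphic, then $(X^\Omega,d^\Omega)$ is a Polish metric space and the induced action $G\wr\Omega\curvearrowright(X^\Omega,d^\Omega)$ is continuous and approximately oligomorphic. (An approximately oligomorphic action can exist only on a bounded space, so boundedness of $X$ is no restriction.) 2. If $G$ is Roelcke precompact, then so is $G\wr\Omega$. -/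

import Mathlib

open MeasureTheory Filter Topology

universe u v w

/-! ### Isometric actions: metric quotients, approximate oligomorphy, faithfulness -/

section IsometricActions

variable (G : Type u) [Group G] (X : Type v) [MetricSpace X] [MulAction G X]

/-- The metric quotient `X // G`, as a set: the set of closures of `G`-orbits in `X`. -/
def MetricQuotient : Type v :=
  {C : Set X // ∃ x : X, C = closure (MulAction.orbit G x)}

namespace MetricQuotient

variable {X}

/-- The quotient map, sending `x` to the closure of its orbit. -/
def mk (x : X) : MetricQuotient G X := ⟨closure (MulAction.orbit G x), x, rfl⟩

variable {G}

/-- A point whose orbit closure is `C`. -/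
noncomputable def rep (C : MetricQuotient G X) : X := C.2.choose

theorem mk_rep (C : MetricQuotient G X) : mk G C.rep = C :=
  Subtype.ext C.2.choose_spec.symm

theorem mk_eq_mk_iff {x y : X} :
    mk G x = mk G y ↔ closure (MulAction.orbit G x) = closure (MulAction.orbit G y) := by
  exact Subtype.ext_iff

variable (G) in
/-- `inf_{g ∈ G} d(x, g y)`, for points `x` and `y` of `X`. -/
noncomputable def preDist (x y : X) : ℝ := ⨅ g : G, dist x (g • y)

theorem preDist_eq_infDist (x y : X) :
    preDist G x y = Metric.infDist x (closure (MulAction.orbit G y)) := by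
  rw [Metric.infDist_closure, Metric.infDist_eq_iInf]
  have : Nonempty (MulAction.orbit G y) := ⟨⟨y, MulAction.mem_orbit_self y⟩⟩
  apply le_antisymm
  · refine le_ciInf ?_
    rintro ⟨_, g, rfl⟩
    exact ciInf_le ⟨0, by rintro _ ⟨g, rfl⟩; exact dist_nonneg⟩ g
  · refine le_ciInf fun g => ?_
    exact ciInf_le (f := fun z : MulAction.orbit G y => dist x z)
      ⟨0, by rintro _ ⟨g, rfl⟩; exact dist_nonneg⟩ ⟨g • y, g, rfl⟩

variable [IsIsometricSMul G X]

theorem preDist_comm (x y : X) : preDist G x y = preDist G y x := by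
  unfold preDist
  rw [← (Equiv.inv G).iInf_comp]
  refine iInf_congr fun g => ?_
  rw [Equiv.inv_apply, dist_comm, ← dist_smul g, smul_inv_smul, dist_comm, dist_comm]

theorem preDist_congr {x x' y y' : X} (hx : mk G x = mk G x') (hy : mk G y = mk G y') :
    preDist G x y = preDist G x' y' := by
  rw [mk_eq_mk_iff] at hx hy
  rw [preDist_eq_infDist, hy, ← preDist_eq_infDist, preDist_comm, preDist_eq_infDist, hx,
    ← preDist_eq_infDist, preDist_comm]

theorem preDist_triangle (x y z : X) : preDist G x z ≤ preDist G x y + preDist G y z := by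
  rw [← sub_le_iff_le_add]
  refine le_ciInf fun g => ?_
  rw [sub_le_iff_le_add]
  have h1 : preDist G (g • y) z = preDist G y z := by
    apply preDist_congr _ rfl
    rw [mk_eq_mk_iff, MulAction.orbit_smul]
  rw [← h1, preDist_eq_infDist, preDist_eq_infDist, add_comm]
  exact Metric.infDist_le_infDist_add_dist

theorem mk_eq_of_preDist {x y : X} (h : preDist G x y = 0) : mk G x = mk G y := by
  have key : ∀ a b : X, preDist G a b = 0 →
      closure (MulAction.orbit G a) ⊆ closure (MulAction.orbit G b) := by
    intro a b hab
    refine closure_minimal ?_ isClosed_closure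
    rintro _ ⟨g, rfl⟩
    have hga : preDist G (g • a) b = 0 := by
      rw [← hab]
      apply preDist_congr _ rfl
      rw [mk_eq_mk_iff, MulAction.orbit_smul]
    rw [preDist_eq_infDist] at hga
    exact (isClosed_closure.mem_iff_infDist_zero
      ⟨b, subset_closure (MulAction.mem_orbit_self b)⟩).2 hga
  rw [mk_eq_mk_iff]
  exact Set.Subset.antisymm (key x y h) (key y x (by rw [preDist_comm, h]))

/-- The metric of the metric quotient: the distance between the orbit closures of `x` and `y` is
`inf_{g ∈ G} d(x, g y)`; see `MetricQuotient.dist_mk_mk`. -/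
noncomputable instance : MetricSpace (MetricQuotient G X) where
  dist C D := preDist G C.rep D.rep
  dist_self C := by
    rw [preDist_eq_infDist]
    exact Metric.infDist_zero_of_mem (subset_closure (MulAction.mem_orbit_self _))
  dist_comm C D := preDist_comm _ _
  dist_triangle C D E := preDist_triangle _ _ _
  eq_of_dist_eq_zero {C D} h := by
    rw [← mk_rep C, ← mk_rep D]
    exact mk_eq_of_preDist h

theorem dist_mk_mk (x y : X) : dist (mk G x) (mk G y) = ⨅ g : G, dist x (g • y) :=
  preDist_congr (mk_rep _) (mk_rep _)

end MetricQuotient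

/-- An isometric action of `G` on `X` is approximately oligomorphic if for every `n` the metric
quotient of `X ^ n` (with the supremum distance) by the diagonal action of `G` is compact. -/
def IsApproxOligomorphic [IsIsometricSMul G X] : Prop :=
  ∀ n : ℕ, CompactSpace (MetricQuotient G (Fin n → X))

/-- An isometric action of a topological group `G` on `X` is faithful if the induced map from `G`
to the isometries of `X` is a topological embedding, where the isometries of `X` carry the topology
of pointwise convergence (i.e. the subspace topology inherited from the product `X → X`). -/
def IsTopologicallyFaithful [TopologicalSpace G] : Prop :=
  IsEmbedding (fun (g : G) (x : X) => g • x)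

end IsometricActions

/-- A (Polish) group is Roelcke precompact if it has a faithful approximately oligomorphic action on
some Polish (i.e. complete and separable) metric space. (A Polish space has at most continuum many
points, so it is enough to consider spaces in the lowest universe.) -/
def IsRoelckePrecompact (G : Type u) [Group G] [TopologicalSpace G] : Prop :=
  ∃ (X : Type) (_ : MetricSpace X) (_ : MulAction G X) (_ : IsIsometricSMul G X),
    CompleteSpace X ∧ TopologicalSpace.SeparableSpace X ∧ IsTopologicallyFaithful G X ∧ IsApproxOligomorphic G X

/-! ### Spaces of random variables

`Ω →ₘ[μ] X` is the space of random variables on `(Ω, μ)` with values in `X`, up to almost everywhere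
equality. For a bounded metric space `X` it carries the `L¹`-distance. -/

section RandomVariables

variable {Ω : Type w} [MeasurableSpace Ω] {μ : Measure Ω} [IsProbabilityMeasure μ]

theorem integrable_dist_aeEqFun {X : Type v} [MetricSpace X] [BoundedSpace X] (r s : Ω →ₘ[μ] X) :
    Integrable (fun ω => dist (r ω) (s ω)) μ := by
  refine Integrable.of_bound (r.aestronglyMeasurable.dist s.aestronglyMeasurable)
    (Metric.diam (Set.univ : Set X)) (Eventually.of_forall fun ω => ?_)
  rw [Real.norm_of_nonneg dist_nonneg]
  exact Metric.dist_le_diam_of_mem (Bornology.IsBounded.all _) (Set.mem_univ _) (Set.mem_univ _)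

/-- The induced `L¹`-distance `∫ d(r(ω), s(ω)) dμ(ω)` on the space of random variables with values
in a bounded metric space. -/
noncomputable instance aeEqFunMetricSpace {X : Type v} [MetricSpace X] [BoundedSpace X] :
    MetricSpace (Ω →ₘ[μ] X) where
  dist r s := ∫ ω, dist (r ω) (s ω) ∂μ
  dist_self r := by simp
  dist_comm r s := by simp [dist_comm]
  dist_triangle r s t := by
    rw [← integral_add (integrable_dist_aeEqFun r s) (integrable_dist_aeEqFun s t)]
    exact integral_mono (integrable_dist_aeEqFun r t)
      ((integrable_dist_aeEqFun r s).add (integrable_dist_aeEqFun s t))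
      fun ω => dist_triangle _ _ _
  eq_of_dist_eq_zero {r s} h := by
    have h' := (integral_eq_zero_iff_of_nonneg (fun ω => dist_nonneg)
      (integrable_dist_aeEqFun r s)).1 h
    refine AEEqFun.ext ?_
    filter_upwards [h'] with ω hω
    exact dist_eq_zero.1 hω

theorem aeEqFun_dist_def {X : Type v} [MetricSpace X] [BoundedSpace X] (r s : Ω →ₘ[μ] X) :
    dist r s = ∫ ω, dist (r ω) (s ω) ∂μ := rfl

/-- A bounded metric compatible with the topology of a metrizable space: `min 1 d` where `d` is any
compatible metric. -/
@[reducible] noncomputable def boundedCompatibleMetric (Y : Type v) [TopologicalSpace Y]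
    [TopologicalSpace.MetrizableSpace Y] : MetricSpace Y :=
  letI m := TopologicalSpace.metrizableSpaceMetric Y
  MetricSpace.ofDistTopology (fun x y : Y => min 1 (dist x y))
    (fun x => by simp) (fun x y => by rw [dist_comm])
    (fun x y z => by
      have h := dist_triangle x y z
      have h1 := dist_nonneg (x := x) (y := y)
      have h2 := dist_nonneg (x := y) (y := z)
      rcases min_cases 1 (dist x y) with h3 | h3 <;> rcases min_cases 1 (dist y z) with h4 | h4 <;>
        rcases min_cases 1 (dist x z) with h5 | h5 <;> linarith)
    (fun s => by
      rw [Metric.isOpen_iff]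
      refine forall₂_congr fun x _ => ⟨?_, ?_⟩
      · rintro ⟨ε, hε, hs⟩
        refine ⟨min ε 1, lt_min hε one_pos, fun y hy => hs ?_⟩
        rw [Metric.mem_ball, dist_comm]
        rcases min_cases 1 (dist x y) with h3 | h3
        · exact absurd (h3.1 ▸ lt_of_lt_of_le hy (min_le_right _ _)) (lt_irrefl _)
        · exact h3.1 ▸ lt_of_lt_of_le hy (min_le_left _ _)
      · rintro ⟨ε, hε, hs⟩
        refine ⟨ε, hε, fun y hy => hs y ?_⟩
        rw [Metric.mem_ball, dist_comm] at hy
        exact lt_of_le_of_lt (min_le_right _ _) hy)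
    (fun x y h => by
      rcases min_cases 1 (dist x y) with h3 | h3
      · linarith
      · exact dist_eq_zero.1 (h3.1 ▸ h))

theorem boundedCompatibleMetric_boundedSpace (Y : Type v) [TopologicalSpace Y]
    [TopologicalSpace.MetrizableSpace Y] :
    @BoundedSpace Y (boundedCompatibleMetric Y).toBornology := by
  let m := boundedCompatibleMetric Y
  refine ⟨Metric.isBounded_iff.2 ⟨1, fun x _ y _ => ?_⟩⟩
  exact min_le_left 1 ((TopologicalSpace.metrizableSpaceMetric Y).dist x y)

variable (μ) in
/-- The topology on the space of random variables with values in a metrizable topological space `Y`: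
the one induced by the `L¹`-distance of any compatible bounded distance on `Y`. It does not depend
on the choice, see `aeEqFunTopology_eq`. -/
@[reducible] noncomputable def aeEqFunTopology (Y : Type v) [TopologicalSpace Y]
    [TopologicalSpace.MetrizableSpace Y] : TopologicalSpace (Ω →ₘ[μ] Y) :=
  letI _ := boundedCompatibleMetric Y
  haveI := boundedCompatibleMetric_boundedSpace Y
  (aeEqFunMetricSpace (μ := μ) (X := Y)).toUniformSpace.toTopologicalSpace

/-- Convergence in the `L¹`-distance: every subsequence has a further subsequence that converges
almost surely. -/
theorem tendsto_aeEqFun_iff {X : Type v} [MetricSpace X] [BoundedSpace X] (r : ℕ → Ω →ₘ[μ] X)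
    (s : Ω →ₘ[μ] X) :
    Tendsto r atTop (𝓝 s) ↔ ∀ ns : ℕ → ℕ, Tendsto ns atTop atTop → ∃ ms : ℕ → ℕ,
      StrictMono ms ∧ ∀ᵐ ω ∂μ, Tendsto (fun k => r (ns (ms k)) ω) atTop (𝓝 (s ω)) := by
  constructor
  · intro h ns hns
    have h1 := (tendsto_iff_dist_tendsto_zero.1 h).comp hns
    have h2 : Tendsto (fun n => eLpNorm ((fun ω => dist (r (ns n) ω) (s ω)) - 0) 1 μ) atTop (𝓝 0) := by
      have h3 : ∀ n, eLpNorm ((fun ω => dist (r (ns n) ω) (s ω)) - 0) 1 μ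
          = ENNReal.ofReal (dist (r (ns n)) s) := by
        intro n
        rw [sub_zero, eLpNorm_one_eq_lintegral_enorm, aeEqFun_dist_def,
          ofReal_integral_eq_lintegral_ofReal (integrable_dist_aeEqFun _ _)
            (Eventually.of_forall fun _ => dist_nonneg)]
        refine lintegral_congr fun ω => ?_
        rw [Real.enorm_of_nonneg dist_nonneg]
      simp_rw [h3]
      simpa using ENNReal.tendsto_ofReal h1
    have h4 := tendstoInMeasure_of_tendsto_eLpNorm (μ := μ) one_ne_zero
      (fun n => (integrable_dist_aeEqFun (r (ns n)) s).aestronglyMeasurable)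
      aestronglyMeasurable_zero h2
    obtain ⟨ms, hms, hae⟩ := h4.exists_seq_tendsto_ae
    refine ⟨ms, hms, ?_⟩
    filter_upwards [hae] with ω hω
    exact tendsto_iff_dist_tendsto_zero.2 hω
  · intro h
    refine tendsto_of_subseq_tendsto fun ns hns => ?_
    obtain ⟨ms, -, hae⟩ := h ns hns
    refine ⟨ms, tendsto_iff_dist_tendsto_zero.2 ?_⟩
    simp_rw [aeEqFun_dist_def]
    have := tendsto_integral_of_dominated_convergence (μ := μ)
      (F := fun k ω => dist (r (ns (ms k)) ω) (s ω)) (f := fun _ => (0 : ℝ))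
      (fun _ => Metric.diam (Set.univ : Set X))
      (fun k => (integrable_dist_aeEqFun _ _).aestronglyMeasurable) (integrable_const _)
      (fun k => Eventually.of_forall fun ω => by
        rw [Real.norm_of_nonneg dist_nonneg]
        exact Metric.dist_le_diam_of_mem (Bornology.IsBounded.all _) (Set.mem_univ _)
          (Set.mem_univ _))
      (by
        filter_upwards [hae] with ω hω
        exact tendsto_iff_dist_tendsto_zero.1 hω)
    simpa using this

/-- The topology on the space of random variables is the one given by the `L¹`-distance of an
arbitrary compatible bounded distance. -/
theorem aeEqFunTopology_eq (X : Type v) [m : MetricSpace X] [BoundedSpace X] :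
    aeEqFunTopology μ X =
      (aeEqFunMetricSpace (μ := μ) (X := X)).toUniformSpace.toTopologicalSpace := by
  have key : ∀ (r : ℕ → Ω →ₘ[μ] X) (s : Ω →ₘ[μ] X),
      Tendsto r atTop (@nhds _ (aeEqFunTopology μ X) s) ↔ Tendsto r atTop (𝓝 s) := by
    intro r s
    rw [tendsto_aeEqFun_iff]
    exact @tendsto_aeEqFun_iff Ω _ μ _ X (boundedCompatibleMetric X)
      (boundedCompatibleMetric_boundedSpace X) r s
  have hfc : @FirstCountableTopology _ (aeEqFunTopology μ X) := by
    let m := boundedCompatibleMetric X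
    have := boundedCompatibleMetric_boundedSpace X
    exact (inferInstance : FirstCountableTopology (Ω →ₘ[μ] X))
  apply le_antisymm
  · rw [← continuous_id_iff_le]
    have hs := @FrechetUrysohnSpace.to_sequentialSpace _ (aeEqFunTopology μ X)
      (@FirstCountableTopology.frechetUrysohnSpace _ (aeEqFunTopology μ X) hfc)
    refine @SeqContinuous.continuous _ _ (aeEqFunTopology μ X) _ hs id ?_
    intro r s h
    exact (key r s).1 h
  · rw [← continuous_id_iff_le]
    refine @SeqContinuous.continuous _ _ _ (aeEqFunTopology μ X) _ id ?_
    intro r s h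
    exact (key r s).2 h

end RandomVariables

/-! ### The measurable wreath product

`Ω` is a Polish space with its Borel `σ`-algebra and `μ` is a Borel probability measure on it. -/

section Wreath

set_option linter.unusedSectionVars false

variable {Ω : Type w} [TopologicalSpace Ω] [PolishSpace Ω] [MeasurableSpace Ω] [BorelSpace Ω]
  (μ : Measure Ω) [IsProbabilityMeasure μ]

/-- The measure-preserving transformations of `(Ω, μ)`, up to almost everywhere equality. -/
def MeasureEnd : Type w := {f : Ω →ₘ[μ] Ω // MeasurePreserving f μ μ}

variable {μ}

namespace MeasureEnd

/-- Precomposition `r ∘ f` of a random variable `r` by a measure-preserving transformation `f`. -/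
noncomputable def precomp {Y : Type v} [TopologicalSpace Y] (r : Ω →ₘ[μ] Y) (f : MeasureEnd μ) :
    Ω →ₘ[μ] Y :=
  r.compMeasurePreserving f.1 f.2

theorem coeFn_precomp {Y : Type v} [TopologicalSpace Y] (r : Ω →ₘ[μ] Y) (f : MeasureEnd μ) :
    ⇑(precomp r f) =ᵐ[μ] fun ω => r (f.1 ω) :=
  AEEqFun.coeFn_compMeasurePreserving _ _

/-- The identity. -/
noncomputable instance : One (MeasureEnd μ) :=
  ⟨AEEqFun.mk id aestronglyMeasurable_id, by
    refine (MeasurePreserving.id μ).congr (AEEqFun.measurable _) ?_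
    exact (AEEqFun.coeFn_mk _ _).symm⟩

/-- The product is composition: `(f * g)(ω) = f(g(ω))`. -/
noncomputable instance : Mul (MeasureEnd μ) :=
  ⟨fun f g => ⟨precomp f.1 g, (f.2.comp g.2).congr (AEEqFun.measurable _) (coeFn_precomp _ _).symm⟩⟩

theorem coeFn_one : ⇑(1 : MeasureEnd μ).1 =ᵐ[μ] fun ω => ω := AEEqFun.coeFn_mk _ _

theorem coeFn_mul (f g : MeasureEnd μ) : ⇑(f * g).1 =ᵐ[μ] fun ω => f.1 (g.1 ω) :=
  coeFn_precomp _ _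

theorem precomp_one {Y : Type v} [TopologicalSpace Y] (r : Ω →ₘ[μ] Y) : precomp r 1 = r := by
  refine AEEqFun.ext ?_
  filter_upwards [coeFn_precomp r 1, coeFn_one (μ := μ)] with ω h1 h2
  rw [h1, h2]

theorem precomp_mul {Y : Type v} [TopologicalSpace Y] (r : Ω →ₘ[μ] Y) (f g : MeasureEnd μ) :
    precomp r (f * g) = precomp (precomp r f) g := by
  refine AEEqFun.ext ?_
  filter_upwards [coeFn_precomp r (f * g), coeFn_mul f g, coeFn_precomp (precomp r f) g,
    g.2.quasiMeasurePreserving.ae (coeFn_precomp r f)] with ω h1 h2 h3 h4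
  rw [h1, h2, h3, h4]

noncomputable instance : Monoid (MeasureEnd μ) where
  mul_assoc f g h := Subtype.ext (precomp_mul f.1 g h).symm
  one_mul f := by
    refine Subtype.ext (AEEqFun.ext ?_)
    filter_upwards [coeFn_mul 1 f, f.2.quasiMeasurePreserving.ae (coeFn_one (μ := μ))] with ω h1 h2
    rw [h1, h2]
  mul_one f := Subtype.ext (precomp_one f.1)

end MeasureEnd

variable (μ) in
/-- `Aut(Ω)`: the group of invertible measure-preserving transformations of `(Ω, μ)`, up to almost
everywhere equality. -/
abbrev MeasureAut : Type w := (MeasureEnd μ)ˣ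

namespace MeasureAut

/-- The action of `t ∈ Aut(Ω)` on a random variable `r`, given by `(t r)(ω) = r(t⁻¹(ω))`. -/
noncomputable def act {Y : Type v} [TopologicalSpace Y] (t : MeasureAut μ) (r : Ω →ₘ[μ] Y) :
    Ω →ₘ[μ] Y :=
  MeasureEnd.precomp r (t⁻¹ : MeasureAut μ).1

theorem coeFn_act {Y : Type v} [TopologicalSpace Y] (t : MeasureAut μ) (r : Ω →ₘ[μ] Y) :
    ⇑(act t r) =ᵐ[μ] fun ω => r ((t⁻¹ : MeasureAut μ).1.1 ω) :=
  MeasureEnd.coeFn_precomp _ _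

theorem act_one {Y : Type v} [TopologicalSpace Y] (r : Ω →ₘ[μ] Y) :
    act (1 : MeasureAut μ) r = r := by
  rw [act, inv_one, Units.val_one, MeasureEnd.precomp_one]

theorem act_mul {Y : Type v} [TopologicalSpace Y] (t u : MeasureAut μ) (r : Ω →ₘ[μ] Y) :
    act (t * u) r = act t (act u r) := by
  rw [act, act, act, mul_inv_rev, Units.val_mul, MeasureEnd.precomp_mul]

/-- The topology of `Aut(Ω)`: pointwise convergence for its action on the metric space of random
variables with values in `[0, 1]`. -/
noncomputable instance : TopologicalSpace (MeasureAut μ) :=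
  TopologicalSpace.induced
    (fun (t : MeasureAut μ) (r : Ω →ₘ[μ] unitInterval) => act t r) Pi.topologicalSpace

/-- The action of `Aut(Ω)` by automorphisms on the group of `G`-valued random variables (with
pointwise multiplication). -/
noncomputable def actHom (G : Type u) [Group G] [TopologicalSpace G] [IsTopologicalGroup G] :
    MeasureAut μ →* MulAut (Ω →ₘ[μ] G) where
  toFun t :=
    { toFun := act t
      invFun := act t⁻¹
      left_inv := fun g => by rw [← act_mul, inv_mul_cancel, act_one]
      right_inv := fun g => by rw [← act_mul, mul_inv_cancel, act_one]
      map_mul' := fun g h => by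
        refine AEEqFun.ext ?_
        filter_upwards [coeFn_act t (g * h), AEEqFun.coeFn_mul (act t g) (act t h), coeFn_act t g,
          coeFn_act t h, (t⁻¹ : MeasureAut μ).1.2.quasiMeasurePreserving.ae
            (AEEqFun.coeFn_mul g h)] with ω h1 h2 h3 h4 h5
        rw [h1, h2, h5, Pi.mul_apply, Pi.mul_apply, h3, h4] }
  map_one' := MulEquiv.ext fun g => act_one g
  map_mul' t u := MulEquiv.ext fun g => act_mul t u g

end MeasureAut

variable (μ) in
/-- The measurable wreath product `G ≀ Ω`: the semidirect product of the group of `G`-valued random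
variables and `Aut(Ω)`. -/
def MeasureWreath (G : Type u) [Group G] [TopologicalSpace G] [IsTopologicalGroup G] :
    Type (max u w) :=
  (Ω →ₘ[μ] G) ⋊[MeasureAut.actHom G] MeasureAut μ

namespace MeasureWreath

variable {G : Type u} [Group G] [TopologicalSpace G] [IsTopologicalGroup G]

noncomputable instance : Group (MeasureWreath μ G) :=
  inferInstanceAs (Group ((Ω →ₘ[μ] G) ⋊[MeasureAut.actHom G] MeasureAut μ))

/-- The component in the group of `G`-valued random variables. -/
def base (x : MeasureWreath μ G) : Ω →ₘ[μ] G := SemidirectProduct.left x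

/-- The component in `Aut(Ω)`. -/
def top (x : MeasureWreath μ G) : MeasureAut μ := SemidirectProduct.right x

/-- The product topology. -/
noncomputable instance [TopologicalSpace.MetrizableSpace G] :
    TopologicalSpace (MeasureWreath μ G) :=
  (aeEqFunTopology μ G).induced base ⊓ TopologicalSpace.induced top inferInstance

/-- The induced action of `G ≀ Ω` on the space of random variables with values in a `G`-space `X`:
a pair `(g, t)` sends `r` to `ω ↦ g(ω) r(t⁻¹(ω))`. -/
noncomputable instance {X : Type v} [TopologicalSpace X] [MulAction G X] [ContinuousSMul G X] :
    SMul (MeasureWreath μ G) (Ω →ₘ[μ] X) :=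
  ⟨fun x r => AEEqFun.comp₂ (fun (g : G) (p : X) => g • p) continuous_smul x.base (x.top.act r)⟩

theorem coeFn_smul {X : Type v} [TopologicalSpace X] [MulAction G X] [ContinuousSMul G X]
    (x : MeasureWreath μ G) (r : Ω →ₘ[μ] X) :
    ⇑(x • r) =ᵐ[μ] fun ω => x.base ω • r ((x.top⁻¹ : MeasureAut μ).1.1 ω) := by
  filter_upwards [AEEqFun.coeFn_comp₂ (fun (g : G) (p : X) => g • p) continuous_smul x.base
    (x.top.act r), MeasureAut.coeFn_act x.top r] with ω h1 h2
  rw [← h2]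
  exact h1

noncomputable instance {X : Type v} [TopologicalSpace X] [MulAction G X] [ContinuousSMul G X] :
    MulAction (MeasureWreath μ G) (Ω →ₘ[μ] X) where
  one_smul r := by
    refine AEEqFun.ext ?_
    filter_upwards [AEEqFun.coeFn_comp₂ (fun (g : G) (p : X) => g • p) continuous_smul
      (1 : MeasureWreath μ G).base ((1 : MeasureWreath μ G).top.act r),
      AEEqFun.coeFn_one (α := Ω) (μ := μ) (β := G)] with ω h1 h2
    refine h1.trans ?_
    have h3 : (1 : MeasureWreath μ G).base ω = 1 := h2
    have h4 : (1 : MeasureWreath μ G).top.act r = r := MeasureAut.act_one r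
    rw [h3, h4, one_smul]
  mul_smul x y r := by
    refine AEEqFun.ext ?_
    have hb : (x * y).base = x.base * x.top.act y.base := rfl
    have ht : (x * y).top.act r = x.top.act (y.top.act r) := MeasureAut.act_mul x.top y.top r
    have e1 := AEEqFun.coeFn_comp₂ (fun (g : G) (p : X) => g • p) continuous_smul
      (x * y).base ((x * y).top.act r)
    have e2 := coeFn_smul x (y • r)
    have e3 := (x.top⁻¹ : MeasureAut μ).1.2.quasiMeasurePreserving.ae
      (AEEqFun.coeFn_comp₂ (fun (g : G) (p : X) => g • p) continuous_smul y.base (y.top.act r))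
    rw [hb, ht] at e1
    have e0 : (x * y) • r = AEEqFun.comp₂ (fun (g : G) (p : X) => g • p) continuous_smul
        (x.base * x.top.act y.base) (x.top.act (y.top.act r)) := by
      rw [← hb, ← ht]
      rfl
    rw [← e0] at e1
    filter_upwards [e1, e2, e3, AEEqFun.coeFn_mul x.base (x.top.act y.base),
      MeasureAut.coeFn_act x.top y.base, MeasureAut.coeFn_act x.top (y.top.act r)]
      with ω h1 h2 h3 h4 h5 h6
    have h3' : (y • r) ((x.top⁻¹ : MeasureAut μ).1.1 ω) = _ := h3
    rw [h2, h3', ← mul_smul, ← h5, ← h6, ← Pi.mul_apply, ← h4]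
    exact h1

instance {X : Type v} [MetricSpace X] [BoundedSpace X] [MulAction G X] [ContinuousSMul G X]
    [IsIsometricSMul G X] : IsIsometricSMul (MeasureWreath μ G) (Ω →ₘ[μ] X) where
  isometry_smul x := by
    refine Isometry.of_dist_eq fun r s => ?_
    set f := (x.top⁻¹ : MeasureAut μ).1 with hf
    have h : ∀ᵐ ω ∂μ, dist ((x • r) ω) ((x • s) ω) = dist (r (f.1 ω)) (s (f.1 ω)) := by
      filter_upwards [coeFn_smul x r, coeFn_smul x s] with ω h1 h2
      rw [h1, h2, dist_smul]
    rw [aeEqFun_dist_def, integral_congr_ae h, aeEqFun_dist_def]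
    have h' := integral_map (μ := μ) f.2.measurable.aemeasurable
      (f := fun ω => dist (r ω) (s ω)) (by
        rw [f.2.map_eq]
        exact (integrable_dist_aeEqFun r s).aestronglyMeasurable)
    rw [f.2.map_eq] at h'
    exact h'.symm

end MeasureWreath

end Wreath

/-! ### Spaces of random variables: continuity, completeness, separability -/

section RandomVariablesTopology

variable {Ω : Type w} [MeasurableSpace Ω] {μ : Measure Ω} [IsProbabilityMeasure μ]

/-! Topology. The topology of `Ω →ₘ[μ] Y` depends only on that of `Y`, so any bounded compatible
metric may be used, a complete one when completeness matters. Convergence of random variables can be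
tested on countably many continuous maps inducing the topology of `Y` (`tendsto_aeEqFun_of_comp`);
embedding a separable `X` in the Hilbert cube thus reduces questions to `[0,1]`-valued variables,
the ones that define the topology of `Aut(Ω)`. The map `t ↦ (t⁻¹, t)` embeds `Aut(Ω)` as a closed
set of pairs of `Ω`-valued random variables, so `Aut(Ω)` is Polish, and `G ≀ Ω` is topologically the
product of two Polish spaces.

Approximate oligomorphy. An `n`-tuple of random variables is a random point of `X ^ n`. Take
finitely many `y k` whose orbits are dense up to `ε / 2`. A measurable selection
(`exists_measurable_index`) gives an index `i(ω)` and `γ(ω) ∈ G` such that `γ(ω) • y (i(ω))` is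
close to the tuple at `ω`. The factor `γ` is absorbed by `G^Ω`, and only the finite partition `i`
remains. As `Ω` is atomless, two partitions with almost equal masses are conjugate under `Aut(Ω)`
outside a small set (`exists_measureAut_index`), which costs little because `X` is bounded. Mass
vectors lie in a compact cube, so finitely many partitions suffice. Since quotients of complete
spaces are complete, such finite nets of orbits give compactness.

Roelcke precompactness. The action on `X^Ω` need not be faithful: if `X` is a point, `Aut(Ω)` is
lost. Hence `X` is replaced by `X × [0,1]` with trivial action on the second factor, which stays
approximately oligomorphic because `[0,1]` is compact. Constant variables then recover the `G^Ω`
component, and variables moving only in `[0,1]` recover the `Aut(Ω)` component. -/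

theorem exists_completeSpace_boundedSpace_metric (Y : Type v) [t : TopologicalSpace Y]
    [PolishSpace Y] :
    ∃ m : MetricSpace Y, m.toUniformSpace.toTopologicalSpace = t ∧
      @BoundedSpace Y m.toBornology ∧ @CompleteSpace Y m.toUniformSpace := by
  let m₀ := TopologicalSpace.upgradeIsCompletelyMetrizable Y
  have hmin : ∀ x y : Y, dist x y < 1 → min 1 (dist x y) = dist x y :=
    fun x y h => min_eq_right h.le
  let m : MetricSpace Y := MetricSpace.ofDistTopology (fun x y : Y => min 1 (dist x y))
    (fun x => by simp) (fun x y => by rw [dist_comm])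
    (fun x y z => by
      have h := dist_triangle x y z
      have h1 := dist_nonneg (x := x) (y := y)
      have h2 := dist_nonneg (x := y) (y := z)
      rcases min_cases 1 (dist x y) with h3 | h3 <;> rcases min_cases 1 (dist y z) with h4 | h4 <;>
        rcases min_cases 1 (dist x z) with h5 | h5 <;> linarith)
    (fun s => by
      rw [Metric.isOpen_iff]
      refine forall₂_congr fun x _ => ⟨?_, ?_⟩
      · rintro ⟨ε, hε, hs⟩
        refine ⟨min ε 1, lt_min hε one_pos, fun y hy => hs ?_⟩
        rw [Metric.mem_ball, dist_comm]
        have := (lt_min_iff.1 hy)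
        exact hmin x y ((min_lt_iff.1 this.2).resolve_left (lt_irrefl _)) ▸ this.1
      · rintro ⟨ε, hε, hs⟩
        refine ⟨ε, hε, fun y hy => hs y ?_⟩
        rw [Metric.mem_ball, dist_comm] at hy
        exact lt_of_le_of_lt (min_le_right _ _) hy)
    (fun x y h => by
      rcases min_cases 1 (dist x y) with h3 | h3
      · linarith
      · exact dist_eq_zero.1 (h3.1 ▸ h))
  refine ⟨m, rfl, ?_, ?_⟩
  · refine ⟨Metric.isBounded_iff.2 ⟨1, fun x _ y _ => ?_⟩⟩
    exact min_le_left 1 (m₀.dist x y)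
  · refine @Metric.complete_of_cauchySeq_tendsto Y m.toPseudoMetricSpace fun s hs => ?_
    -- Truncation at 1 leaves distances below 1 unchanged, so the two metrics have the same Cauchy
    -- sequences.
    have hs' : @CauchySeq Y ℕ m₀.toUniformSpace _ s := by
      refine (@Metric.cauchySeq_iff Y ℕ m₀.toPseudoMetricSpace _ _ s).2 ?_
      replace hs := (@Metric.cauchySeq_iff Y ℕ m.toPseudoMetricSpace _ _ s).1 hs
      intro ε hε
      obtain ⟨N, hN⟩ := hs (min ε 1) (lt_min hε one_pos)
      refine ⟨N, fun a ha b hb => ?_⟩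
      have h := lt_min_iff.1 (hN a ha b hb)
      exact (hmin _ _ ((min_lt_iff.1 h.2).resolve_left (lt_irrefl _))) ▸ h.1
    exact @cauchySeq_tendsto_of_complete Y ℕ m₀.toUniformSpace _ _ _ hs'

theorem aeEqFun_dist_eq_of_ae {X : Type v} [MetricSpace X] [BoundedSpace X] {r s : Ω →ₘ[μ] X}
    {f : Ω → ℝ} (h : ∀ᵐ ω ∂μ, dist (r ω) (s ω) = f ω) : dist r s = ∫ ω, f ω ∂μ :=
  integral_congr_ae h

theorem aeEqFun_dist_le_of_ae {X : Type v} [MetricSpace X] [BoundedSpace X] {r s : Ω →ₘ[μ] X}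
    {c : ℝ} (h : ∀ᵐ ω ∂μ, dist (r ω) (s ω) ≤ c) : dist r s ≤ c := by
  refine (integral_mono_ae (integrable_dist_aeEqFun r s) (integrable_const c) h).trans ?_
  simp

theorem continuous_aeEqFun_comp {Y : Type u} {Z : Type v} [MetricSpace Y] [BoundedSpace Y]
    [MetricSpace Z] [BoundedSpace Z] (φ : Y → Z) (hφ : Continuous φ) :
    Continuous fun r : Ω →ₘ[μ] Y => r.comp φ hφ := by
  refine SeqContinuous.continuous fun r s h => ?_
  rw [tendsto_aeEqFun_iff] at h ⊢
  intro ns hns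
  obtain ⟨ms, hms, hae⟩ := h ns hns
  refine ⟨ms, hms, ?_⟩
  filter_upwards [hae, ae_all_iff.2 fun n => AEEqFun.coeFn_comp φ hφ (r n),
    AEEqFun.coeFn_comp φ hφ s] with ω h1 h2 h3
  simp only [Function.comp_apply, h2, h3]
  exact (hφ.tendsto _).comp h1

theorem dist_aeEqFun_pair_le {Y : Type u} {Z : Type v} [MetricSpace Y] [BoundedSpace Y]
    [MetricSpace Z] [BoundedSpace Z] (r r' : Ω →ₘ[μ] Y) (s s' : Ω →ₘ[μ] Z) :
    dist (r.pair s) (r'.pair s') ≤ dist r r' + dist s s' := by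
  rw [aeEqFun_dist_def, aeEqFun_dist_def, aeEqFun_dist_def, ← integral_add
    (integrable_dist_aeEqFun r r') (integrable_dist_aeEqFun s s')]
  refine integral_mono_ae (integrable_dist_aeEqFun _ _)
    ((integrable_dist_aeEqFun r r').add (integrable_dist_aeEqFun s s')) ?_
  filter_upwards [AEEqFun.coeFn_pair r s, AEEqFun.coeFn_pair r' s'] with ω h1 h2
  simp only [h1, h2, Prod.dist_eq]
  exact max_le_add_of_nonneg dist_nonneg dist_nonneg

theorem continuous_aeEqFun_pair {Y : Type u} {Z : Type v} [MetricSpace Y] [BoundedSpace Y]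
    [MetricSpace Z] [BoundedSpace Z] :
    Continuous fun p : (Ω →ₘ[μ] Y) × (Ω →ₘ[μ] Z) => p.1.pair p.2 := by
  rw [continuous_iff_continuousAt]
  intro p
  refine tendsto_iff_dist_tendsto_zero.2 (squeeze_zero (fun _ => dist_nonneg)
    (fun q => dist_aeEqFun_pair_le q.1 p.1 q.2 p.2) ?_)
  have : Continuous fun q : (Ω →ₘ[μ] Y) × (Ω →ₘ[μ] Z) => dist q.1 p.1 + dist q.2 p.2 := by
    fun_prop
  simpa using this.tendsto p

theorem continuous_aeEqFun_comp₂ {Y : Type u} {Z : Type v} {W : Type*} [MetricSpace Y]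
    [BoundedSpace Y] [MetricSpace Z] [BoundedSpace Z] [MetricSpace W] [BoundedSpace W]
    (φ : Y → Z → W) (hφ : Continuous (Function.uncurry φ)) :
    Continuous fun p : (Ω →ₘ[μ] Y) × (Ω →ₘ[μ] Z) => AEEqFun.comp₂ φ hφ p.1 p.2 := by
  simp_rw [AEEqFun.comp₂_eq_pair]
  exact (continuous_aeEqFun_comp _ hφ).comp continuous_aeEqFun_pair

/-- Convergence of random variables can be tested on a countable family of continuous maps which
induces the topology. -/
theorem tendsto_aeEqFun_of_comp {ι : Type*} {l : Filter ι} {Y : Type u} [m₁ : MetricSpace Y]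
    [BoundedSpace Y] {Z : ℕ → Type v} [∀ k, MetricSpace (Z k)] [∀ k, BoundedSpace (Z k)]
    (φ : ∀ k, Y → Z k) (hφ : ∀ k, Continuous (φ k)) (hind : IsInducing fun y k => φ k y)
    {r : ι → Ω →ₘ[μ] Y} {s : Ω →ₘ[μ] Y}
    (h : ∀ k, Tendsto (fun i => (r i).comp (φ k) (hφ k)) l (𝓝 (s.comp (φ k) (hφ k)))) :
    Tendsto r l (𝓝 s) := by
  have hinj : Function.Injective fun y k => φ k y := hind.injective
  let m₂ : MetricSpace Y := (MetricSpace.induced _ hinj PiCountable.metricSpace).replaceTopology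
    hind.eq_induced
  have hd : ∀ x y : Y, m₂.dist x y = ∑' k : ℕ, min (2⁻¹ ^ k) (dist (φ k x) (φ k y)) := by
    intro x y
    exact PiCountable.dist_eq_tsum (fun k => φ k x) (fun k => φ k y)
  have hgeo : Summable fun k : ℕ => (2⁻¹ : ℝ) ^ k :=
    summable_geometric_of_lt_one (by norm_num) (by norm_num)
  have hb₂ : @BoundedSpace Y m₂.toBornology := by
    refine ⟨Metric.isBounded_iff.2 ⟨∑' k : ℕ, (2⁻¹ : ℝ) ^ k, fun x _ y _ => ?_⟩⟩
    rw [show dist x y = _ from hd x y]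
    refine Summable.tsum_le_tsum (fun k => min_le_left _ _) ?_ hgeo
    exact Summable.of_nonneg_of_le (fun k => by positivity) (fun k => min_le_left _ _) hgeo
  -- Both metrics induce the topology of `Y`, so `m₁` may be exchanged for the series metric `m₂`,
  -- whose `L¹`-distance splits into a sum over `k`.
  have htop : (@aeEqFunMetricSpace Ω _ μ _ Y m₁ _).toUniformSpace.toTopologicalSpace =
      (@aeEqFunMetricSpace Ω _ μ _ Y m₂ hb₂).toUniformSpace.toTopologicalSpace :=
    (@aeEqFunTopology_eq Ω _ μ _ Y m₁ _).symm.trans (@aeEqFunTopology_eq Ω _ μ _ Y m₂ hb₂)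
  rw [htop]
  refine (@tendsto_iff_dist_tendsto_zero _ _ (@aeEqFunMetricSpace Ω _ μ _ Y m₂ hb₂).toPseudoMetricSpace
    _ _ _).2 ?_
  have hint : ∀ i k, Integrable (fun ω => min ((2⁻¹ : ℝ) ^ k) (dist (φ k (r i ω)) (φ k (s ω)))) μ := by
    intro i k
    refine Integrable.of_bound (C := 2⁻¹ ^ k) ?_ (Eventually.of_forall fun ω => ?_)
    · exact (aestronglyMeasurable_const).inf
        (((hφ k).comp_aestronglyMeasurable (r i).aestronglyMeasurable).dist
          ((hφ k).comp_aestronglyMeasurable s.aestronglyMeasurable))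
    · rw [Real.norm_of_nonneg (by positivity)]
      exact min_le_left _ _
  have hle1 : ∀ i k, ∫ ω, min ((2⁻¹ : ℝ) ^ k) (dist (φ k (r i ω)) (φ k (s ω))) ∂μ ≤ 2⁻¹ ^ k := by
    intro i k
    refine (integral_mono (hint i k) (integrable_const _) fun ω => min_le_left _ _).trans ?_
    simp
  have hle2 : ∀ i k, ∫ ω, min ((2⁻¹ : ℝ) ^ k) (dist (φ k (r i ω)) (φ k (s ω))) ∂μ ≤
      dist ((r i).comp (φ k) (hφ k)) (s.comp (φ k) (hφ k)) := by
    intro i k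
    refine integral_mono_ae (hint i k) (integrable_dist_aeEqFun _ _) ?_
    filter_upwards [AEEqFun.coeFn_comp (φ k) (hφ k) (r i), AEEqFun.coeFn_comp (φ k) (hφ k) s]
      with ω h1 h2
    simp only [h1, h2]
    exact min_le_right _ _
  have hnn : ∀ i k, 0 ≤ ∫ ω, min ((2⁻¹ : ℝ) ^ k) (dist (φ k (r i ω)) (φ k (s ω))) ∂μ :=
    fun i k => integral_nonneg fun ω => by positivity
  have heq : ∀ i, (@aeEqFunMetricSpace Ω _ μ _ Y m₂ hb₂).dist (r i) s =
      ∑' k : ℕ, ∫ ω, min ((2⁻¹ : ℝ) ^ k) (dist (φ k (r i ω)) (φ k (s ω))) ∂μ := by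
    intro i
    rw [integral_tsum_of_summable_integral_norm (hint i)]
    · exact integral_congr_ae (Eventually.of_forall fun ω => hd _ _)
    · refine Summable.of_nonneg_of_le (fun k => integral_nonneg fun ω => norm_nonneg _)
        (fun k => ?_) hgeo
      refine le_trans (le_of_eq ?_) (hle1 i k)
      exact integral_congr_ae (Eventually.of_forall fun ω => Real.norm_of_nonneg (by positivity))
  refine (tendsto_congr heq).2 ?_
  -- Each term tends to 0 by `h k` and is at most `2⁻¹ ^ k` uniformly in `i`, so the sum tends to 0.
  -- This works along any filter, with no passage to subsequences.
  have := tendsto_tsum_of_dominated_convergence (𝓕 := l) (g := fun _ : ℕ => (0 : ℝ)) hgeo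
    (f := fun i k => ∫ ω, min ((2⁻¹ : ℝ) ^ k) (dist (φ k (r i ω)) (φ k (s ω))) ∂μ)
    (fun k => squeeze_zero (fun i => hnn i k) (fun i => hle2 i k)
      (tendsto_iff_dist_tendsto_zero.1 (h k)))
    (Eventually.of_forall fun i k => by
      rw [Real.norm_of_nonneg (hnn i k)]
      exact hle1 i k)
  simpa using this

theorem isInducing_aeEqFun_comp {Y : Type u} [MetricSpace Y] [BoundedSpace Y] {Z : ℕ → Type v}
    [∀ k, MetricSpace (Z k)] [∀ k, BoundedSpace (Z k)] (φ : ∀ k, Y → Z k)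
    (hφ : ∀ k, Continuous (φ k)) (hind : IsInducing fun y k => φ k y) :
    IsInducing fun (r : Ω →ₘ[μ] Y) k => r.comp (φ k) (hφ k) := by
  refine isInducing_iff_nhds.2 fun r => le_antisymm ?_ ?_
  · rw [← tendsto_iff_comap]
    exact (continuous_pi fun k => continuous_aeEqFun_comp (φ k) (hφ k)).tendsto r
  · have h := tendsto_comap (f := fun (r : Ω →ₘ[μ] Y) k => r.comp (φ k) (hφ k))
      (x := 𝓝 fun k => r.comp (φ k) (hφ k))
    exact tendsto_aeEqFun_of_comp φ hφ hind (r := id) (tendsto_pi_nhds.1 h)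

/-- The Riesz–Fischer argument: along a sequence with summable consecutive distances, the sum of the
pointwise distances has finite integral, so almost every sample path is Cauchy. -/
instance aeEqFun_completeSpace {X : Type v} [MetricSpace X] [BoundedSpace X] [CompleteSpace X] :
    CompleteSpace (Ω →ₘ[μ] X) := by
  refine Metric.complete_of_convergent_controlled_sequences (fun n => 2⁻¹ ^ n)
    (fun n => by positivity) fun r hr => ?_
  have hr' : ∀ n, dist (r n) (r (n + 1)) ≤ 2⁻¹ ^ n :=
    fun n => (hr n n (n + 1) le_rfl n.le_succ).le
  have hgeo : Summable fun k : ℕ => (2⁻¹ : ℝ) ^ k :=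
    summable_geometric_of_lt_one (by norm_num) (by norm_num)
  have hmeas : ∀ n, AEMeasurable (fun ω => edist (r n ω) (r (n + 1) ω)) μ := by
    intro n
    simp_rw [edist_dist]
    exact ((r n).aestronglyMeasurable.dist (r (n + 1)).aestronglyMeasurable).aemeasurable.ennreal_ofReal
  have hfin : ∫⁻ ω, ∑' n, edist (r n ω) (r (n + 1) ω) ∂μ ≠ ⊤ := by
    rw [lintegral_tsum hmeas]
    have h1 : ∀ n, ∫⁻ ω, edist (r n ω) (r (n + 1) ω) ∂μ ≤ ENNReal.ofReal (2⁻¹ ^ n) := by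
      intro n
      refine le_trans (le_of_eq ?_) (ENNReal.ofReal_le_ofReal (hr' n))
      rw [aeEqFun_dist_def, ofReal_integral_eq_lintegral_ofReal (integrable_dist_aeEqFun _ _)
        (Eventually.of_forall fun _ => dist_nonneg)]
      simp_rw [edist_dist]
    refine ne_top_of_le_ne_top ?_ (ENNReal.tsum_le_tsum h1)
    exact hgeo.tsum_ofReal_ne_top
  have hlim : ∀ᵐ ω ∂μ, ∃ x, Tendsto (fun n => r n ω) atTop (𝓝 x) := by
    filter_upwards [ae_lt_top' (AEMeasurable.tsum hmeas) hfin] with ω hω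
    exact cauchySeq_tendsto_of_complete
      (cauchySeq_of_edist_le_of_tsum_ne_top _ (fun n => le_rfl) hω.ne)
  obtain ⟨s, hs, hrs⟩ := exists_stronglyMeasurable_limit_of_tendsto_ae
    (fun n => (r n).aestronglyMeasurable) hlim
  refine ⟨AEEqFun.mk s hs.aestronglyMeasurable, (tendsto_aeEqFun_iff _ _).2 fun ns hns =>
    ⟨id, strictMono_id, ?_⟩⟩
  filter_upwards [hrs, AEEqFun.coeFn_mk s hs.aestronglyMeasurable] with ω h1 h2
  rw [h2]
  exact h1.comp hns

/-- These variables embed isometrically in the real `L¹(μ)`, which is separable because the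
σ-algebra is countably generated. -/
theorem aeEqFun_unitInterval_secondCountableTopology [MeasurableSpace.CountablyGenerated Ω] :
    SecondCountableTopology (Ω →ₘ[μ] unitInterval) := by
  have hint : ∀ r : Ω →ₘ[μ] unitInterval, Integrable (fun ω => (r ω : ℝ)) μ := fun r =>
    Integrable.of_bound (C := 1)
      (continuous_subtype_val.comp_aestronglyMeasurable r.aestronglyMeasurable)
      (Eventually.of_forall fun ω => by
        rw [Real.norm_of_nonneg (r ω).2.1]
        exact (r ω).2.2)
  have hiso : Isometry fun r : Ω →ₘ[μ] unitInterval => (hint r).toL1 _ := by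
    refine Isometry.of_dist_eq fun r s => ?_
    rw [dist_eq_norm, ← Integrable.toL1_sub, L1.norm_of_fun_eq_integral_norm, aeEqFun_dist_def]
    rfl
  have : Fact ((1 : ENNReal) ≠ ⊤) := ⟨ENNReal.one_ne_top⟩
  exact hiso.isEmbedding.isInducing.secondCountableTopology

instance aeEqFun_secondCountableTopology [MeasurableSpace.CountablyGenerated Ω] {X : Type v}
    [MetricSpace X] [BoundedSpace X] [TopologicalSpace.SeparableSpace X] :
    SecondCountableTopology (Ω →ₘ[μ] X) := by
  have := aeEqFun_unitInterval_secondCountableTopology (μ := μ)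
  obtain ⟨F, hF⟩ := Metric.PiNatEmbed.exists_embedding_to_hilbert_cube (X := X)
  exact (isInducing_aeEqFun_comp (μ := μ) (fun k x => F x k)
    (fun k => (continuous_apply k).comp hF.continuous) hF.isInducing).secondCountableTopology

end RandomVariablesTopology

/-! ### The topological group of measure-preserving transformations -/

section MeasureAutTopology

variable {Ω : Type w} [TopologicalSpace Ω] [PolishSpace Ω] [MeasurableSpace Ω] [BorelSpace Ω]
  {μ : Measure Ω} [IsProbabilityMeasure μ]

namespace MeasureEnd

theorem dist_precomp {X : Type v} [MetricSpace X] [BoundedSpace X] (r s : Ω →ₘ[μ] X)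
    (f : MeasureEnd μ) : dist (precomp r f) (precomp s f) = dist r s := by
  have h : ∀ᵐ ω ∂μ, dist (precomp r f ω) (precomp s f ω) = dist (r (f.1 ω)) (s (f.1 ω)) := by
    filter_upwards [coeFn_precomp r f, coeFn_precomp s f] with ω h1 h2
    rw [h1, h2]
  rw [aeEqFun_dist_eq_of_ae h, aeEqFun_dist_def]
  have h' := integral_map (μ := μ) f.2.measurable.aemeasurable
    (f := fun ω => dist (r ω) (s ω)) (by
      rw [f.2.map_eq]
      exact (integrable_dist_aeEqFun r s).aestronglyMeasurable)
  rw [f.2.map_eq] at h'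
  exact h'.symm

theorem comp_precomp {X : Type u} {Y : Type v} [TopologicalSpace X] [TopologicalSpace Y]
    (φ : X → Y) (hφ : Continuous φ) (r : Ω →ₘ[μ] X) (f : MeasureEnd μ) :
    (precomp r f).comp φ hφ = precomp (r.comp φ hφ) f := by
  refine AEEqFun.ext ?_
  filter_upwards [AEEqFun.coeFn_comp φ hφ (precomp r f), coeFn_precomp r f,
    coeFn_precomp (r.comp φ hφ) f,
    f.2.quasiMeasurePreserving.ae (AEEqFun.coeFn_comp φ hφ r)] with ω h1 h2 h3 h4
  rw [h1, h3, h4, Function.comp_apply, Function.comp_apply, h2]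

end MeasureEnd

namespace MeasureAut

theorem dist_act {X : Type v} [MetricSpace X] [BoundedSpace X] (t : MeasureAut μ)
    (r s : Ω →ₘ[μ] X) : dist (act t r) (act t s) = dist r s :=
  MeasureEnd.dist_precomp r s _

theorem act_left {X : Type v} [TopologicalSpace X] (t : MeasureAut μ) (r : Ω →ₘ[μ] X) :
    act t⁻¹ (act t r) = r := by
  rw [← act_mul, inv_mul_cancel, act_one]

theorem tendsto_iff {ι : Type*} {l : Filter ι} {t : ι → MeasureAut μ} {t₀ : MeasureAut μ} :
    Tendsto t l (𝓝 t₀) ↔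
      ∀ r : Ω →ₘ[μ] unitInterval, Tendsto (fun i => act (t i) r) l (𝓝 (act t₀ r)) := by
  rw [nhds_induced, tendsto_comap_iff, tendsto_pi_nhds]
  rfl

theorem tendsto_act_const {ι : Type*} {l : Filter ι} {t : ι → MeasureAut μ} {t₀ : MeasureAut μ}
    (ht : Tendsto t l (𝓝 t₀)) {X : Type v} [MetricSpace X] [BoundedSpace X]
    [TopologicalSpace.SeparableSpace X] (r : Ω →ₘ[μ] X) :
    Tendsto (fun i => act (t i) r) l (𝓝 (act t₀ r)) := by
  obtain ⟨F, hF⟩ := Metric.PiNatEmbed.exists_embedding_to_hilbert_cube (X := X)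
  refine tendsto_aeEqFun_of_comp (fun k x => F x k)
    (fun k => (continuous_apply k).comp hF.continuous) hF.isInducing fun k => ?_
  simp_rw [act, MeasureEnd.comp_precomp]
  exact tendsto_iff.1 ht _

theorem tendsto_act {ι : Type*} {l : Filter ι} {t : ι → MeasureAut μ} {t₀ : MeasureAut μ}
    (ht : Tendsto t l (𝓝 t₀)) {X : Type v} [MetricSpace X] [BoundedSpace X]
    [TopologicalSpace.SeparableSpace X] {r : ι → Ω →ₘ[μ] X} {r₀ : Ω →ₘ[μ] X}
    (hr : Tendsto r l (𝓝 r₀)) : Tendsto (fun i => act (t i) (r i)) l (𝓝 (act t₀ r₀)) := by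
  rw [tendsto_iff_dist_tendsto_zero]
  refine squeeze_zero (fun _ => dist_nonneg)
    (fun i => (dist_triangle _ (act (t i) r₀) _).trans_eq (by rw [dist_act])) ?_
  simpa using (tendsto_iff_dist_tendsto_zero.1 hr).add
    (tendsto_iff_dist_tendsto_zero.1 (tendsto_act_const ht r₀))

instance : IsTopologicalGroup (MeasureAut μ) where
  continuous_mul := by
    refine continuous_iff_continuousAt.2 fun p => tendsto_iff.2 fun r => ?_
    simp_rw [act_mul]
    exact tendsto_act (continuous_fst.tendsto p) (tendsto_act_const (continuous_snd.tendsto p) r)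
  continuous_inv := by
    refine continuous_iff_continuousAt.2 fun t => tendsto_iff.2 fun r => ?_
    -- By invariance of the distance, `u⁻¹ r` is as far from `t⁻¹ r` as `r = t (t⁻¹ r)` is from `u
    -- (t⁻¹ r)`.
    have h := tendsto_act_const (tendsto_id (x := 𝓝 t)) (act t⁻¹ r)
    rw [tendsto_iff_dist_tendsto_zero] at h ⊢
    refine h.congr fun u => ?_
    rw [← dist_act u⁻¹, id, act_left, ← act_mul t, mul_inv_cancel, act_one, dist_comm]

end MeasureAut

/-! ### Automorphisms as `Ω`-valued random variables, for a bounded metric on `Ω`. -/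

section BoundedMetric

set_option linter.unusedSectionVars false

variable {Ω : Type w} [MetricSpace Ω] [BoundedSpace Ω] [PolishSpace Ω] [MeasurableSpace Ω]
  [BorelSpace Ω] {μ : Measure Ω} [IsProbabilityMeasure μ]

/-- Bounded continuous functions are dense in `L¹(μ)`, and clipping to `[0,1]` is 1-Lipschitz and
fixes the values of `r`. Writing the approximant as `φ` composed with the identity variable lets
`precomp_comp_one` turn precomposition by `f` into `φ ∘ f`. -/
theorem exists_continuous_dist_aeEqFun_le (r : Ω →ₘ[μ] unitInterval) {ε : ℝ} (hε : 0 < ε) :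
    ∃ φ : Ω → unitInterval, ∃ hφ : Continuous φ,
      dist r ((1 : MeasureEnd μ).1.comp φ hφ) ≤ ε := by
  have hint : Integrable (fun ω => (r ω : ℝ)) μ :=
    Integrable.of_bound (C := 1)
      (continuous_subtype_val.comp_aestronglyMeasurable r.aestronglyMeasurable)
      (Eventually.of_forall fun ω => by
        rw [Real.norm_of_nonneg (r ω).2.1]
        exact (r ω).2.2)
  obtain ⟨g, hg, hgi⟩ := hint.exists_boundedContinuous_integral_sub_le hε
  have hφ : Continuous fun ω => Set.projIcc (0 : ℝ) 1 zero_le_one (g ω) :=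
    continuous_projIcc.comp g.continuous
  refine ⟨_, hφ, le_trans (integral_mono_ae (integrable_dist_aeEqFun _ _)
    (hint.sub hgi).norm ?_) hg⟩
  filter_upwards [AEEqFun.coeFn_comp _ hφ (1 : MeasureEnd μ).1, MeasureEnd.coeFn_one (μ := μ)]
    with ω h1 h2
  rw [h1, Function.comp_apply, h2]
  simp only [Pi.sub_apply, Real.norm_eq_abs]
  have h3 := Set.abs_projIcc_sub_projIcc (zero_le_one' ℝ) (c := (r ω : ℝ)) (d := g ω)
  rwa [Set.projIcc_val] at h3

namespace MeasureEnd

theorem precomp_comp_one {X : Type v} [TopologicalSpace X] (φ : Ω → X) (hφ : Continuous φ)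
    (f : MeasureEnd μ) : precomp ((1 : MeasureEnd μ).1.comp φ hφ) f = f.1.comp φ hφ := by
  rw [← comp_precomp]
  exact congrArg (AEEqFun.comp φ hφ) (congrArg Subtype.val (one_mul f))

/-- Precomposition depends continuously on the measure-preserving transformation. -/
theorem tendsto_precomp {ι : Type*} {l : Filter ι} {f : ι → MeasureEnd μ} {f₀ : MeasureEnd μ}
    (hf : Tendsto (fun i => (f i).1) l (𝓝 f₀.1)) {X : Type v} [MetricSpace X] [BoundedSpace X]
    [TopologicalSpace.SeparableSpace X] (r : Ω →ₘ[μ] X) :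
    Tendsto (fun i => precomp r (f i)) l (𝓝 (precomp r f₀)) := by
  have key : ∀ r : Ω →ₘ[μ] unitInterval,
      Tendsto (fun i => precomp r (f i)) l (𝓝 (precomp r f₀)) := by
    intro r
    refine Metric.tendsto_nhds.2 fun ε hε => ?_
    -- Precomposition is isometric, so replacing `r` by `φ` costs `ε / 3` at `f i` and again at
    -- `f₀`; the middle third is `φ ∘ f i → φ ∘ f₀`.
    obtain ⟨φ, hφ, hr⟩ := exists_continuous_dist_aeEqFun_le r (show 0 < ε / 3 by positivity)
    have h := Metric.tendsto_nhds.1 (((continuous_aeEqFun_comp φ hφ).tendsto _).comp hf) (ε / 3)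
      (by positivity)
    filter_upwards [h] with i hi
    simp only [Function.comp_apply] at hi
    rw [← precomp_comp_one φ hφ (f i), ← precomp_comp_one φ hφ f₀] at hi
    have h1 := dist_triangle4 (precomp r (f i)) (precomp ((1 : MeasureEnd μ).1.comp φ hφ) (f i))
      (precomp ((1 : MeasureEnd μ).1.comp φ hφ) f₀) (precomp r f₀)
    rw [dist_precomp, dist_precomp, dist_comm _ r] at h1
    linarith
  obtain ⟨F, hF⟩ := Metric.PiNatEmbed.exists_embedding_to_hilbert_cube (X := X)
  refine tendsto_aeEqFun_of_comp (fun k x => F x k)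
    (fun k => (continuous_apply k).comp hF.continuous) hF.isInducing fun k => ?_
  simp_rw [comp_precomp]
  exact key _

theorem tendsto_mul {ι : Type*} {l : Filter ι} {f g : ι → MeasureEnd μ} {f₀ g₀ : MeasureEnd μ}
    (hf : Tendsto (fun i => (f i).1) l (𝓝 f₀.1)) (hg : Tendsto (fun i => (g i).1) l (𝓝 g₀.1)) :
    Tendsto (fun i => (f i * g i).1) l (𝓝 (f₀ * g₀).1) := by
  rw [tendsto_iff_dist_tendsto_zero]
  refine squeeze_zero (fun _ => dist_nonneg)
    (fun i => (dist_triangle _ (precomp f₀.1 (g i)) _).trans_eq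
      (congrArg₂ _ (dist_precomp (f i).1 f₀.1 (g i)) rfl)) ?_
  have h := (tendsto_iff_dist_tendsto_zero.1 hf).add
    (tendsto_iff_dist_tendsto_zero.1 (tendsto_precomp hg f₀.1))
  rw [add_zero] at h
  exact h

/-- Integrals of bounded continuous functions determine the image measure, and they pass to the
limit along an almost surely convergent subsequence. -/
theorem measurePreserving_of_tendsto {f : ℕ → Ω →ₘ[μ] Ω} {f₀ : Ω →ₘ[μ] Ω}
    (hf : ∀ n, MeasurePreserving (f n) μ μ) (h : Tendsto f atTop (𝓝 f₀)) :
    MeasurePreserving f₀ μ μ := by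
  refine ⟨f₀.measurable, ?_⟩
  have : IsProbabilityMeasure (μ.map f₀) :=
    Measure.isProbabilityMeasure_map f₀.measurable.aemeasurable
  refine ext_of_forall_integral_eq_of_IsFiniteMeasure fun φ => ?_
  obtain ⟨ms, -, hae⟩ := (tendsto_aeEqFun_iff _ _).1 h id tendsto_id
  rw [integral_map f₀.measurable.aemeasurable φ.continuous.aestronglyMeasurable]
  have h1 : Tendsto (fun k => ∫ ω, φ (f (ms k) ω) ∂μ) atTop (𝓝 (∫ ω, φ (f₀ ω) ∂μ)) := by
    refine tendsto_integral_of_dominated_convergence (fun _ => ‖φ‖)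
      (fun k => φ.continuous.comp_aestronglyMeasurable (f (ms k)).aestronglyMeasurable)
      (integrable_const _) (fun k => Eventually.of_forall fun ω => φ.norm_coe_le_norm _) ?_
    filter_upwards [hae] with ω hω
    exact (φ.continuous.tendsto _).comp hω
  have h2 : ∀ k, ∫ ω, φ (f (ms k) ω) ∂μ = ∫ ω, φ ω ∂μ := by
    intro k
    rw [← integral_map (hf (ms k)).measurable.aemeasurable
      φ.continuous.aestronglyMeasurable, (hf (ms k)).map_eq]
  simp_rw [h2] at h1
  exact tendsto_nhds_unique h1 tendsto_const_nhds

end MeasureEnd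

namespace MeasureAut

theorem act_one_val (t : MeasureAut μ) : act t (1 : MeasureEnd μ).1 = (t⁻¹).1.1 :=
  congrArg Subtype.val (one_mul (t⁻¹ : MeasureAut μ).1)

theorem isInducing_inv_val : IsInducing fun t : MeasureAut μ => (t⁻¹).1.1 := by
  refine isInducing_iff_nhds.2 fun t => le_antisymm ?_ ?_
  · rw [← tendsto_iff_comap]
    simp_rw [← act_one_val]
    exact tendsto_act_const tendsto_id _
  · have h := tendsto_comap (f := fun t : MeasureAut μ => (t⁻¹).1.1) (x := 𝓝 (t⁻¹).1.1)
    exact tendsto_iff.2 fun r => MeasureEnd.tendsto_precomp h r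

/-- A limit of automorphisms alone may fail to be invertible. Recording `t⁻¹` and `t` together makes
both inverse relations survive in the limit, because multiplication is jointly continuous
(`tendsto_mul`). -/
theorem isClosedEmbedding_inv_val_prod_val :
    IsClosedEmbedding fun t : MeasureAut μ => ((t⁻¹).1.1, t.1.1) := by
  have hc : Continuous fun t : MeasureAut μ => ((t⁻¹).1.1, t.1.1) := by
    refine isInducing_inv_val.continuous.prodMk ?_
    have := isInducing_inv_val.continuous.comp (continuous_inv (G := MeasureAut μ))
    simpa [Function.comp_def] using this
  refine ⟨⟨isInducing_inv_val.of_comp hc continuous_fst, fun t u h => ?_⟩, ?_⟩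
  · exact Units.ext (Subtype.ext (Prod.ext_iff.1 h).2)
  · refine IsSeqClosed.isClosed fun x p hx hp => ?_
    choose t ht using hx
    have h1 : Tendsto (fun n => ((t n)⁻¹).1.1) atTop (𝓝 p.1) := by
      simpa [← ht, Function.comp_def] using (continuous_fst.tendsto p).comp hp
    have h2 : Tendsto (fun n => (t n).1.1) atTop (𝓝 p.2) := by
      simpa [← ht, Function.comp_def] using (continuous_snd.tendsto p).comp hp
    let f : MeasureEnd μ :=
      ⟨p.1, MeasureEnd.measurePreserving_of_tendsto (fun n => ((t n)⁻¹).1.2) h1⟩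
    let g : MeasureEnd μ :=
      ⟨p.2, MeasureEnd.measurePreserving_of_tendsto (fun n => (t n).1.2) h2⟩
    have hfg : f * g = 1 := by
      have := MeasureEnd.tendsto_mul (f₀ := f) (g₀ := g) h1 h2
      simp_rw [Units.inv_mul] at this
      exact Subtype.ext (tendsto_nhds_unique this tendsto_const_nhds)
    have hgf : g * f = 1 := by
      have := MeasureEnd.tendsto_mul (f₀ := g) (g₀ := f) h2 h1
      simp_rw [Units.mul_inv] at this
      exact Subtype.ext (tendsto_nhds_unique this tendsto_const_nhds)
    exact ⟨⟨g, f, hgf, hfg⟩, rfl⟩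

end MeasureAut

end BoundedMetric

instance MeasureAut.instPolishSpace : PolishSpace (MeasureAut μ) := by
  rename_i t _ _ _ _
  obtain ⟨m, rfl, _, _⟩ := exists_completeSpace_boundedSpace_metric Ω
  exact (MeasureAut.isClosedEmbedding_inv_val_prod_val (μ := μ)).polishSpace

end MeasureAutTopology

/-! ### The topology of the wreath product -/

section MeasureWreathTopology

variable {Ω : Type w} [TopologicalSpace Ω] [PolishSpace Ω] [MeasurableSpace Ω] [BorelSpace Ω]
  {μ : Measure Ω} [IsProbabilityMeasure μ]

namespace MeasureWreath

section Components

variable {G : Type u} [Group G] [TopologicalSpace G] [IsTopologicalGroup G]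

theorem base_mul (x y : MeasureWreath μ G) : (x * y).base = x.base * x.top.act y.base := rfl

theorem top_mul (x y : MeasureWreath μ G) : (x * y).top = x.top * y.top := rfl

theorem base_inv (x : MeasureWreath μ G) : x⁻¹.base = x.top⁻¹.act x.base⁻¹ := rfl

theorem top_inv (x : MeasureWreath μ G) : x⁻¹.top = x.top⁻¹ := rfl

theorem bijective_base_top :
    Function.Bijective fun x : MeasureWreath μ G => (x.base, x.top) :=
  ⟨fun _ _ h => SemidirectProduct.ext (Prod.ext_iff.1 h).1 (Prod.ext_iff.1 h).2,
    fun p => ⟨⟨p.1, p.2⟩, rfl⟩⟩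

end Components

section BoundedMetric

variable {G : Type u} [Group G] [MetricSpace G] [BoundedSpace G] [IsTopologicalGroup G]

theorem isInducing_base_top :
    IsInducing fun x : MeasureWreath μ G => (x.base, x.top) := by
  refine ⟨?_⟩
  rw [instTopologicalSpaceProd, induced_inf, induced_compose, induced_compose,
    ← aeEqFunTopology_eq]
  rfl

theorem tendsto_iff {ι : Type*} {l : Filter ι} {x : ι → MeasureWreath μ G}
    {x₀ : MeasureWreath μ G} :
    Tendsto x l (𝓝 x₀) ↔ Tendsto (fun i => (x i).base) l (𝓝 x₀.base) ∧
      Tendsto (fun i => (x i).top) l (𝓝 x₀.top) := by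
  rw [isInducing_base_top.tendsto_nhds_iff, nhds_prod_eq, tendsto_prod_iff']
  rfl

theorem isTopologicalGroup_of_metric [TopologicalSpace.SeparableSpace G] :
    IsTopologicalGroup (MeasureWreath μ G) := by
  have hmul : Continuous fun p : (Ω →ₘ[μ] G) × (Ω →ₘ[μ] G) => p.1 * p.2 :=
    continuous_aeEqFun_comp₂ (fun a b : G => a * b) continuous_mul
  have hinv : Continuous fun p : Ω →ₘ[μ] G => p⁻¹ :=
    continuous_aeEqFun_comp (fun a : G => a⁻¹) continuous_inv
  refine { continuous_mul := ?_, continuous_inv := ?_ }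
  · refine continuous_iff_continuousAt.2 fun p => tendsto_iff.2 ?_
    obtain ⟨h1, h2⟩ := tendsto_iff.1 (continuous_fst.tendsto p)
    obtain ⟨h3, h4⟩ := tendsto_iff.1 (continuous_snd.tendsto p)
    simp_rw [base_mul, top_mul]
    exact ⟨(hmul.tendsto (p.1.base, p.1.top.act p.2.base)).comp
      (h1.prodMk_nhds (MeasureAut.tendsto_act h2 h3)), h2.mul h4⟩
  · refine continuous_iff_continuousAt.2 fun x => tendsto_iff.2 ?_
    obtain ⟨h1, h2⟩ := tendsto_iff.1 (tendsto_id (x := 𝓝 x))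
    simp_rw [base_inv, top_inv]
    exact ⟨MeasureAut.tendsto_act h2.inv ((hinv.tendsto _).comp h1), h2.inv⟩

theorem polishSpace_of_metric [TopologicalSpace.SeparableSpace G] [CompleteSpace G] :
    PolishSpace (MeasureWreath μ G) := by
  have h : IsClosedEmbedding fun x : MeasureWreath μ G => (x.base, x.top) := by
    refine ⟨⟨isInducing_base_top, bijective_base_top.1⟩, ?_⟩
    rw [bijective_base_top.2.range_eq]
    exact isClosed_univ
  exact h.polishSpace

theorem tendsto_smul_of_metric {X : Type v} [MetricSpace X] [BoundedSpace X]
    [TopologicalSpace.SeparableSpace X] [MulAction G X] [ContinuousSMul G X] {ι : Type*}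
    {l : Filter ι} {x : ι → MeasureWreath μ G} {x₀ : MeasureWreath μ G}
    (hx : Tendsto x l (𝓝 x₀)) {r : ι → Ω →ₘ[μ] X} {r₀ : Ω →ₘ[μ] X} (hr : Tendsto r l (𝓝 r₀)) :
    Tendsto (fun i => x i • r i) l (𝓝 (x₀ • r₀)) := by
  have hsmul : Continuous fun p : (Ω →ₘ[μ] G) × (Ω →ₘ[μ] X) =>
      AEEqFun.comp₂ (fun (g : G) (y : X) => g • y) continuous_smul p.1 p.2 :=
    continuous_aeEqFun_comp₂ _ _
  obtain ⟨h1, h2⟩ := tendsto_iff.1 hx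
  exact (hsmul.tendsto (x₀.base, x₀.top.act r₀)).comp
    (h1.prodMk_nhds (MeasureAut.tendsto_act h2 hr))

end BoundedMetric

variable {G : Type u} [t : TopologicalSpace G] [PolishSpace G] [Group G] [IsTopologicalGroup G]

instance : IsTopologicalGroup (MeasureWreath μ G) := by
  obtain ⟨m, rfl, _, _⟩ := exists_completeSpace_boundedSpace_metric G
  exact isTopologicalGroup_of_metric

instance : PolishSpace (MeasureWreath μ G) := by
  obtain ⟨m, rfl, _, _⟩ := exists_completeSpace_boundedSpace_metric G
  exact polishSpace_of_metric

instance {X : Type v} [MetricSpace X] [BoundedSpace X] [TopologicalSpace.SeparableSpace X]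
    [MulAction G X] [ContinuousSMul G X] : ContinuousSMul (MeasureWreath μ G) (Ω →ₘ[μ] X) := by
  obtain ⟨m, rfl, _, _⟩ := exists_completeSpace_boundedSpace_metric G
  exact ⟨continuous_iff_continuousAt.2 fun p =>
    tendsto_smul_of_metric (continuous_fst.tendsto p) (continuous_snd.tendsto p)⟩

end MeasureWreath

end MeasureWreathTopology

/-! ### Measure-preserving transformations with prescribed values -/

section Transport

set_option linter.unusedSectionVars false

open ProbabilityTheory in
-- The jump of the distribution function at a point is the mass of that point.
theorem continuous_cdf (ν : Measure ℝ) [IsProbabilityMeasure ν] [NullSingletonClass ν] :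
    Continuous (cdf ν) := by
  refine continuous_iff_continuousAt.2 fun x => ?_
  rw [(monotone_cdf ν).continuousAt_iff_leftLim_eq_rightLim, StieltjesFunction.rightLim_eq]
  have h := (cdf ν).measure_singleton x
  rw [measure_cdf, measure_singleton, eq_comm, ENNReal.ofReal_eq_zero, sub_nonpos] at h
  exact le_antisymm ((monotone_cdf ν).leftLim_le le_rfl) h

open ProbabilityTheory in
/-- The distribution function of an atomless probability measure on the line transports it to the
Lebesgue measure on the unit interval. -/
theorem map_cdf (ν : Measure ℝ) [IsProbabilityMeasure ν] [NullSingletonClass ν] :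
    ν.map (cdf ν) = volume.restrict (Set.Icc 0 1) := by
  have hc := continuous_cdf ν
  refine Measure.ext_of_Iic _ _ fun u => ?_
  rw [Measure.map_apply hc.measurable measurableSet_Iic, Measure.restrict_apply measurableSet_Iic]
  rcases lt_or_ge u 0 with hu0 | hu0
  · have h1 : cdf ν ⁻¹' Set.Iic u = ∅ :=
      Set.eq_empty_of_forall_notMem fun x hx => absurd (cdf_nonneg ν x) (not_le.2 (hx.trans_lt hu0))
    have h2 : Set.Iic u ∩ Set.Icc 0 1 = ∅ :=
      Set.eq_empty_of_forall_notMem fun x hx => absurd hx.2.1 (not_le.2 (lt_of_le_of_lt hx.1 hu0))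
    rw [h1, h2, measure_empty, measure_empty]
  rcases le_or_gt 1 u with hu1 | hu1
  · have h1 : cdf ν ⁻¹' Set.Iic u = Set.univ :=
      Set.eq_univ_of_forall fun x => (cdf_le_one ν x).trans hu1
    have h2 : Set.Iic u ∩ Set.Icc 0 1 = Set.Icc 0 1 :=
      Set.inter_eq_right.2 fun x hx => hx.2.trans hu1
    rw [h1, h2, measure_univ, Real.volume_Icc]
    simp
  have h2 : Set.Iic u ∩ Set.Icc 0 1 = Set.Icc 0 u := by
    ext x
    simp only [Set.mem_inter_iff, Set.mem_Iic, Set.mem_Icc]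
    exact ⟨fun h => ⟨h.2.1, h.1⟩, fun h => ⟨h.2, h.1, h.2.trans hu1.le⟩⟩
  rw [h2, Real.volume_Icc, sub_zero]
  rcases (cdf ν ⁻¹' Set.Iic u).eq_empty_or_nonempty with he | hne
  · have h3 : ∀ x, u ≤ cdf ν x := fun x => by
      by_contra hx
      exact Set.eq_empty_iff_forall_notMem.1 he x (not_le.1 hx).le
    have h4 : u ≤ 0 := ge_of_tendsto' (tendsto_cdf_atBot ν) h3
    rw [he, measure_empty, ENNReal.ofReal_of_nonpos h4]
  · obtain ⟨b, hb⟩ := ((tendsto_cdf_atTop ν).eventually (lt_mem_nhds hu1)).exists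
    have hbdd : BddAbove (cdf ν ⁻¹' Set.Iic u) := ⟨b, fun x hx => by
      by_contra hbx
      exact absurd (hb.trans_le (monotone_cdf ν (not_le.1 hbx).le)) (not_lt.2 hx)⟩
    -- By continuity the sublevel set is `Iic z` for its largest point `z`, and the distribution
    -- function equals `u` there.
    have hz := (isClosed_Iic.preimage hc).csSup_mem hne hbdd
    set z := sSup (cdf ν ⁻¹' Set.Iic u)
    have hS : cdf ν ⁻¹' Set.Iic u = Set.Iic z :=
      Set.Subset.antisymm (fun x hx => le_csSup hbdd hx)
        fun x hx => (monotone_cdf ν hx).trans hz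
    have hzu : u ≤ cdf ν z := by
      refine ge_of_tendsto (hc.continuousAt.tendsto.mono_left
        (nhdsWithin_le_nhds (s := Set.Ioi z))) ?_
      filter_upwards [self_mem_nhdsWithin] with x hx
      by_contra hxu
      exact absurd (le_csSup hbdd (show x ∈ cdf ν ⁻¹' Set.Iic u from (not_le.1 hxu).le))
        (not_le.2 hx)
    rw [hS, ← ofReal_cdf, le_antisymm hz hzu]

open ProbabilityTheory in
-- Where injectivity fails, the distribution function is constant on an interval that contains a
-- rational. Deleting the level sets through rationals removes countably many null sets, by
-- `map_cdf`.
theorem exists_injOn_cdf (ν : Measure ℝ) [IsProbabilityMeasure ν] [NullSingletonClass ν] :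
    ∃ S : Set ℝ, MeasurableSet S ∧ ν Sᶜ = 0 ∧ Set.InjOn (cdf ν) S := by
  have hm : ∀ c : ℝ, MeasurableSet (cdf ν ⁻¹' {c}) :=
    fun c => (continuous_cdf ν).measurable (measurableSet_singleton c)
  refine ⟨(⋃ q : ℚ, cdf ν ⁻¹' {cdf ν q})ᶜ, (MeasurableSet.iUnion fun q => hm _).compl, ?_, ?_⟩
  · rw [compl_compl, measure_iUnion_null_iff]
    intro q
    rw [← Measure.map_apply (continuous_cdf ν).measurable (measurableSet_singleton _), map_cdf,
      measure_singleton]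
  · have key : ∀ x ∈ (⋃ q : ℚ, cdf ν ⁻¹' {cdf ν q})ᶜ, ∀ y, x < y → cdf ν x ≠ cdf ν y := by
      intro x hx y hxy h
      obtain ⟨q, h1, h2⟩ := exists_rat_btwn hxy
      refine hx (Set.mem_iUnion.2 ⟨q, le_antisymm (monotone_cdf ν h1.le) ?_⟩)
      rw [h]
      exact monotone_cdf ν h2.le
    intro x hx y hy h
    rcases lt_trichotomy x y with hxy | hxy | hxy
    · exact absurd h (key x hx y hxy)
    · exact hxy
    · exact absurd h.symm (key y hy x hxy)

variable {Ω : Type w} [MeasurableSpace Ω] {μ : Measure Ω} [IsProbabilityMeasure μ]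

/-- An atomless standard probability space is isomorphic, up to null sets, to the unit interval. -/
theorem exists_leftInverse_of_injective [StandardBorelSpace Ω] [NullSingletonClass μ] {e : Ω → ℝ}
    (he : Measurable e) (hinj : Function.Injective e) :
    Measurable (fun ω => μ.real {η | e η ≤ e ω}) ∧
      μ.map (fun ω => μ.real {η | e η ≤ e ω}) = volume.restrict (Set.Icc 0 1) ∧
      ∃ g : ℝ → Ω, Measurable g ∧ ∀ᵐ ω ∂μ, g (μ.real {η | e η ≤ e ω}) = ω := by
  have : IsProbabilityMeasure (μ.map e) := Measure.isProbabilityMeasure_map he.aemeasurable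
  have : NullSingletonClass (μ.map e) := ⟨fun x => by
    rw [Measure.map_apply he (measurableSet_singleton x)]
    exact (Set.subsingleton_singleton.preimage hinj).measure_zero μ⟩
  have hF : (fun ω => μ.real {η | e η ≤ e ω}) = ProbabilityTheory.cdf (μ.map e) ∘ e := by
    ext ω
    rw [Function.comp_apply, ProbabilityTheory.cdf_eq_real, measureReal_def, measureReal_def,
      Measure.map_apply he measurableSet_Iic]
    rfl
  have hF' : ∀ ω, μ.real {η | e η ≤ e ω} = ProbabilityTheory.cdf (μ.map e) (e ω) :=
    fun ω => congrFun hF ω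
  have hmeas : Measurable (ProbabilityTheory.cdf (μ.map e)) := (continuous_cdf _).measurable
  rw [hF]
  refine ⟨hmeas.comp he, by rw [← Measure.map_map hmeas he, map_cdf], ?_⟩
  obtain ⟨S, hS, hS0, hSinj⟩ := exists_injOn_cdf (μ.map e)
  have hT : MeasurableSet (e ⁻¹' S) := he hS
  have := hT.standardBorel
  -- Lusin–Souslin: an injective measurable map on a standard Borel space has a measurable inverse
  -- on its image, which extends to the line.
  have hemb : MeasurableEmbedding fun ω : e ⁻¹' S => ProbabilityTheory.cdf (μ.map e) (e ω) :=
    ((hmeas.comp he).comp measurable_subtype_coe).measurableEmbedding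
      fun x y h => Subtype.ext (hinj (hSinj x.2 y.2 h))
  have hne : Nonempty Ω := nonempty_of_isProbabilityMeasure μ
  obtain ⟨g, hg, hgF⟩ := hemb.exists_measurable_extend measurable_subtype_coe fun _ => hne
  refine ⟨g, hg, ?_⟩
  have hae : ∀ᵐ ω ∂μ, e ω ∈ S := by
    rw [Measure.map_apply he hS.compl] at hS0
    exact hS0
  filter_upwards [hae] with ω hω
  rw [hF']
  exact congrFun hgF ⟨ω, hω⟩

variable [TopologicalSpace Ω] [PolishSpace Ω] [BorelSpace Ω]

/-- The class of a measure-preserving transformation. -/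
noncomputable def MeasureEnd.mk (f : Ω → Ω) (hf : MeasurePreserving f μ μ) : MeasureEnd μ :=
  ⟨AEEqFun.mk f hf.measurable.aestronglyMeasurable,
    hf.congr (AEEqFun.measurable _) (AEEqFun.coeFn_mk _ _).symm⟩

theorem MeasureEnd.coeFn_mk (f : Ω → Ω) (hf : MeasurePreserving f μ μ) :
    ⇑(MeasureEnd.mk f hf).1 =ᵐ[μ] f :=
  AEEqFun.coeFn_mk _ _

theorem MeasureEnd.mk_mul_mk_eq_one {f g : Ω → Ω} (hf : MeasurePreserving f μ μ)
    (hg : MeasurePreserving g μ μ) (h : ∀ᵐ ω ∂μ, f (g ω) = ω) :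
    MeasureEnd.mk f hf * MeasureEnd.mk g hg = 1 := by
  refine Subtype.ext (AEEqFun.ext ?_)
  filter_upwards [MeasureEnd.coeFn_mul (.mk f hf) (.mk g hg), MeasureEnd.coeFn_one (μ := μ),
    (MeasureEnd.mk g hg).2.quasiMeasurePreserving.ae (MeasureEnd.coeFn_mk f hf),
    MeasureEnd.coeFn_mk g hg, h] with ω h1 h2 h3 h4 h5
  rw [h1, h2, h3, h4, h5]

/-- The automorphism is `t = g' ∘ F` with inverse `t⁻¹ = g ∘ F'`: as `F` and `F'` have the same law,
`F ∘ g` and `F' ∘ g'` are the identity almost everywhere for that law. -/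
theorem exists_measureAut_comp_eq {F F' : Ω → ℝ} {g g' : ℝ → Ω} (hF : Measurable F)
    (hF' : Measurable F') (hg : Measurable g) (hg' : Measurable g') (hmap : μ.map F = μ.map F')
    (hgF : ∀ᵐ ω ∂μ, g (F ω) = ω) (hgF' : ∀ᵐ ω ∂μ, g' (F' ω) = ω) :
    ∃ t : MeasureAut μ, ∀ᵐ ω ∂μ, F ((t⁻¹).1.1 ω) = F' ω := by
  have mp : ∀ {F F' : Ω → ℝ} {g : ℝ → Ω}, Measurable F → Measurable F' → Measurable g →
      μ.map F = μ.map F' → (∀ᵐ ω ∂μ, g (F ω) = ω) →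
      MeasurePreserving (fun ω => g (F' ω)) μ μ ∧ ∀ᵐ ω ∂μ, F (g (F' ω)) = F' ω := by
    intro F F' g hF hF' hg hmap hgF
    refine ⟨⟨hg.comp hF', ?_⟩, ?_⟩
    · rw [← Function.comp_def, ← Measure.map_map hg hF', ← hmap, Measure.map_map hg hF]
      exact (Measure.map_congr hgF).trans Measure.map_id
    · refine (ae_map_iff hF'.aemeasurable (p := fun u => F (g u) = u)
        (measurableSet_eq_fun (hF.comp hg) measurable_id)).1 ?_
      rw [← hmap, ae_map_iff hF.aemeasurable (p := fun u => F (g u) = u)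
        (measurableSet_eq_fun (hF.comp hg) measurable_id)]
      filter_upwards [hgF] with ω hω
      rw [hω]
  obtain ⟨hf, hFf⟩ := mp hF hF' hg hmap hgF
  obtain ⟨hf', hFf'⟩ := mp hF' hF hg' hmap.symm hgF'
  refine ⟨⟨.mk _ hf', .mk _ hf, MeasureEnd.mk_mul_mk_eq_one _ _ ?_,
    MeasureEnd.mk_mul_mk_eq_one _ _ ?_⟩, ?_⟩
  · filter_upwards [hFf, hgF'] with ω h1 h2
    rw [h1, h2]
  · filter_upwards [hFf', hgF] with ω h1 h2
    rw [h1, h2]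
  · filter_upwards [MeasureEnd.coeFn_mk _ hf, hFf] with ω h1 h2
    rw [← h2, ← h1]
    rfl

/-- Two finite measurable partitions whose pieces have almost the same measures are conjugate, up
to a small error, by a measure-preserving automorphism. -/
theorem exists_measureAut_index [NullSingletonClass μ] {m : ℕ} {i i' : Ω → Fin m}
    (hi : Measurable i) (hi' : Measurable i') {δ : ℝ}
    (h : ∀ k, |μ.real {ω | i ω ≤ k} - μ.real {ω | i' ω ≤ k}| ≤ δ) :
    ∃ t : MeasureAut μ, ∃ B : Set Ω, MeasurableSet B ∧ μ.real B ≤ m * δ ∧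
      ∀ᵐ ω ∂μ, ω ∉ B → i ((t⁻¹).1.1 ω) = i' ω := by
  obtain ⟨e₀, he₀, he₀inj, he₀I⟩ : ∃ e : Ω → ℝ, Measurable e ∧ Function.Injective e ∧
      ∀ ω, e ω ∈ Set.Icc (0 : ℝ) 1 :=
    ⟨fun ω => unitInterval.sigmoid (embeddingReal Ω ω),
      measurable_subtype_coe.comp (measurableEmbedding_sigmoid_comp_embeddingReal Ω).measurable,
      Subtype.val_injective.comp (measurableEmbedding_sigmoid_comp_embeddingReal Ω).injective,
      fun ω => (unitInterval.sigmoid (embeddingReal Ω ω)).2⟩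
  -- Order `Ω` first by `j`, then by `e₀`, through the injection `2 * j + e₀`; the factor 2 keeps
  -- the pieces apart since `e₀` takes values in `[0,1]`. The resulting isomorphism `F` with the
  -- unit interval lays the pieces out in consecutive intervals cut at the cumulative masses.
  have key : ∀ j : Ω → Fin m, Measurable j → ∃ F : Ω → ℝ, ∃ g : ℝ → Ω, Measurable F ∧ Measurable g ∧
      μ.map F = volume.restrict (Set.Icc 0 1) ∧ (∀ᵐ ω ∂μ, g (F ω) = ω) ∧
      (∀ ω k, j ω ≤ k → F ω ≤ μ.real {ω | j ω ≤ k}) ∧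
      ∀ ω k, k < j ω → μ.real {ω | j ω ≤ k} ≤ F ω := by
    intro j hj
    have hlt : ∀ ω η, j ω < j η → 2 * ((j ω : ℕ) : ℝ) + e₀ ω < 2 * ((j η : ℕ) : ℝ) + e₀ η := by
      intro ω η hωη
      have h1 : (((j ω : ℕ) + 1 : ℕ) : ℝ) ≤ ((j η : ℕ) : ℝ) := Nat.cast_le.2 hωη
      push_cast at h1
      linarith [(he₀I ω).2, (he₀I η).1]
    have hinj : Function.Injective fun ω => 2 * ((j ω : ℕ) : ℝ) + e₀ ω := by
      intro ω η hωη
      rcases lt_trichotomy (j ω) (j η) with h1 | h1 | h1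
      · exact absurd hωη (hlt _ _ h1).ne
      · refine he₀inj ?_
        simpa [h1] using hωη
      · exact absurd hωη (hlt _ _ h1).ne'
    have hmeas : Measurable fun ω => 2 * ((j ω : ℕ) : ℝ) + e₀ ω :=
      ((Measurable.of_discrete (f := fun k : Fin m => 2 * ((k : ℕ) : ℝ))).comp hj).add he₀
    obtain ⟨h1, h2, g, hg, h3⟩ := exists_leftInverse_of_injective (μ := μ) hmeas hinj
    refine ⟨_, g, h1, hg, h2, h3, fun ω k hk => ?_, fun ω k hk => ?_⟩
    · refine measureReal_mono fun η hη => ?_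
      by_contra hηk
      exact absurd hη (not_le.2 (hlt ω η (hk.trans_lt (not_le.1 hηk))))
    · exact measureReal_mono fun η hη => (hlt η ω (lt_of_le_of_lt hη hk)).le
  obtain ⟨F, g, hF, hg, hFmap, hgF, hF1, hF2⟩ := key i hi
  obtain ⟨F', g', hF', hg', hFmap', hgF', hF1', hF2'⟩ := key i' hi'
  obtain ⟨t, ht⟩ := exists_measureAut_comp_eq hF hF' hg hg' (hFmap.trans hFmap'.symm) hgF hgF'
  have hU : MeasurableSet (⋃ k : Fin m,
      Set.uIcc (μ.real {ω | i ω ≤ k}) (μ.real {ω | i' ω ≤ k})) :=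
    MeasurableSet.iUnion fun k => measurableSet_uIcc
  refine ⟨t, F' ⁻¹' ⋃ k : Fin m, Set.uIcc (μ.real {ω | i ω ≤ k}) (μ.real {ω | i' ω ≤ k}),
    hF' hU, ?_, ?_⟩
  · rw [← map_measureReal_apply hF' hU, hFmap']
    refine (measureReal_iUnion_fintype_le _).trans ?_
    refine (Finset.sum_le_sum (g := fun _ => δ) fun k _ => ?_).trans (by simp)
    refine le_trans ?_ (h k)
    refine ENNReal.toReal_le_of_le_ofReal (abs_nonneg _) ((Measure.restrict_apply_le _ _).trans ?_)
    rw [Real.volume_interval, abs_sub_comm]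
  · filter_upwards [ht] with ω hω hB
    by_contra hne
    refine hB (Set.mem_iUnion.2 ?_)
    -- If the indices differ, let `k` be the smaller one: `F' ω = F (t⁻¹ ω)` then lies between the
    -- two cumulative masses at `k`, an interval of length at most `δ`.
    rcases lt_or_gt_of_ne hne with hlt | hlt
    · refine ⟨i ((t⁻¹).1.1 ω), Set.mem_uIcc_of_ge (hF2' _ _ hlt) ?_⟩
      rw [← hω]
      exact hF1 _ _ le_rfl
    · refine ⟨i' ω, Set.mem_uIcc_of_le ?_ (hF1' _ _ le_rfl)⟩
      rw [← hω]
      exact hF2 _ _ hlt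

end Transport

/-! ### Completeness and compactness of metric quotients -/

namespace MetricQuotient

variable {G : Type u} [Group G] {X : Type v} [MetricSpace X] [MulAction G X]

theorem mk_smul (g : G) (x : X) : mk G (g • x) = mk G x := by
  rw [mk_eq_mk_iff, MulAction.orbit_smul]

variable [IsIsometricSMul G X]

theorem dist_mk_lt_iff {x y : X} {ε : ℝ} :
    dist (mk G x) (mk G y) < ε ↔ ∃ g : G, dist x (g • y) < ε := by
  rw [dist_mk_mk]
  exact ciInf_lt_iff ⟨0, by rintro _ ⟨g, rfl⟩; exact dist_nonneg⟩

theorem dist_mk_le (x y : X) : dist (mk G x) (mk G y) ≤ dist x y :=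
  le_of_forall_gt fun ε hε => dist_mk_lt_iff.2 ⟨1, by rwa [one_smul]⟩

/-- A fast Cauchy sequence of classes lifts to a Cauchy sequence in `X`: having lifted one class,
translate a representative of the next by an element of `G` so that it comes close. -/
instance [CompleteSpace X] : CompleteSpace (MetricQuotient G X) := by
  refine Metric.complete_of_convergent_controlled_sequences (fun n => 1 / 2 / 2 ^ n)
    (fun n => by positivity) fun C hC => ?_
  have step : ∀ (n : ℕ) (x : X), mk G x = C n →
      ∃ y, mk G y = C (n + 1) ∧ dist x y < 1 / 2 / 2 ^ n := by
    intro n x hx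
    have h := hC n n (n + 1) le_rfl n.le_succ
    rw [← hx, ← mk_rep (C (n + 1)), dist_mk_lt_iff] at h
    obtain ⟨g, hg⟩ := h
    exact ⟨g • (C (n + 1)).rep, by rw [mk_smul, mk_rep], hg⟩
  choose f hf hd using step
  let x : ∀ n, {x : X // mk G x = C n} := fun n =>
    Nat.rec ⟨(C 0).rep, mk_rep _⟩ (fun n p => ⟨f n p.1 p.2, hf n p.1 p.2⟩) n
  have hx : ∀ n, dist (x n).1 (x (n + 1)).1 ≤ 1 / 2 / 2 ^ n := fun n => (hd n _ _).le
  obtain ⟨a, ha⟩ := cauchySeq_tendsto_of_complete (cauchySeq_of_le_geometric_two hx)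
  refine ⟨mk G a, tendsto_iff_dist_tendsto_zero.2 (squeeze_zero (fun _ => dist_nonneg)
    (fun n => ?_) (tendsto_iff_dist_tendsto_zero.1 ha))⟩
  exact (congrArg (dist · _) (x n).2).symm.trans_le (dist_mk_le _ _)

/-- The metric quotient of a complete space is compact if and only if finitely many orbits are
`ε`-dense, for all `ε > 0`. -/
theorem compactSpace_iff [CompleteSpace X] :
    CompactSpace (MetricQuotient G X) ↔
      ∀ ε > 0, ∃ F : Set X, F.Finite ∧ ∀ x : X, ∃ y ∈ F, ∃ g : G, dist x (g • y) < ε := by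
  rw [← isCompact_univ_iff, isCompact_iff_totallyBounded_isComplete,
    and_iff_left isComplete_univ, Metric.totallyBounded_iff]
  refine forall₂_congr fun ε _ => ⟨?_, ?_⟩
  · rintro ⟨t, ht, hcov⟩
    refine ⟨rep '' t, ht.image _, fun x => ?_⟩
    obtain ⟨C, hC, hx⟩ := Set.mem_iUnion₂.1 (hcov (Set.mem_univ (mk G x)))
    rw [Metric.mem_ball, ← mk_rep C, dist_mk_lt_iff] at hx
    exact ⟨_, Set.mem_image_of_mem _ hC, hx⟩
  · rintro ⟨F, hF, hcov⟩
    refine ⟨mk G '' F, hF.image _, fun C _ => ?_⟩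
    obtain ⟨y, hy, h⟩ := hcov C.rep
    refine Set.mem_iUnion₂.2 ⟨_, Set.mem_image_of_mem _ hy, ?_⟩
    rw [Metric.mem_ball, ← mk_rep C]
    exact dist_mk_lt_iff.2 h

end MetricQuotient

theorem isApproxOligomorphic_iff {G : Type u} [Group G] {X : Type v} [MetricSpace X]
    [CompleteSpace X] [MulAction G X] [IsIsometricSMul G X] :
    IsApproxOligomorphic G X ↔ ∀ (n : ℕ), ∀ ε > 0, ∃ F : Set (Fin n → X), F.Finite ∧
      ∀ x : Fin n → X, ∃ y ∈ F, ∃ g : G, dist x (g • y) < ε :=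
  forall_congr' fun _ => MetricQuotient.compactSpace_iff

/-! ### The action on random variables is approximately oligomorphic -/

section Oligomorphic

variable {Ω : Type w} [MeasurableSpace Ω] {μ : Measure Ω} [IsProbabilityMeasure μ]

/-- The strict inequality is an open condition on the group element, so a countable dense sequence
in `G` suffices. Choosing the first pair that works, in an enumeration of all pairs of an index and
a term of the sequence, is measurable. -/
theorem exists_measurable_index {G : Type u} [Group G] [TopologicalSpace G]
    [TopologicalSpace.SeparableSpace G] {X : Type v} [MetricSpace X] [MulAction G X]
    [ContinuousSMul G X] {n m : ℕ} {ε : ℝ} (hε : 0 < ε)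
    (y : Fin m → Fin n → X)
    (hy : ∀ x : Fin n → X, ∃ (k : Fin m) (g : G), dist x (g • y k) < ε) (r : Fin n → Ω →ₘ[μ] X) :
    ∃ (i : Ω → Fin m) (γ : Ω → G), Measurable i ∧ StronglyMeasurable γ ∧
      ∀ ω, dist (fun j => r j ω) (γ ω • y (i ω)) < ε := by
  have hΩ : Nonempty Ω := nonempty_of_isProbabilityMeasure μ
  have hm : Nonempty (Fin m) := ⟨(hy fun j => r j hΩ.some).choose⟩
  obtain ⟨p, hp⟩ := exists_surjective_nat (Fin m × ℕ)
  let γ₀ : ℕ → G := fun N => TopologicalSpace.denseSeq G (p N).2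
  have hex : ∀ ω, ∃ N, dist (fun j => r j ω) (γ₀ N • y (p N).1) < ε := by
    intro ω
    obtain ⟨k, g, hg⟩ := hy fun j => r j ω
    have hopen : IsOpen {g : G | dist (fun j => r j ω) (g • y k) < ε} :=
      isOpen_lt (by fun_prop) continuous_const
    obtain ⟨l, hl⟩ := (TopologicalSpace.denseRange_denseSeq G).exists_mem_open hopen ⟨g, hg⟩
    obtain ⟨N, hN⟩ := hp (k, l)
    refine ⟨N, ?_⟩
    simp only [γ₀, hN]
    exact hl
  have hmeas : ∀ N, MeasurableSet {ω | dist (fun j => r j ω) (γ₀ N • y (p N).1) < ε} := by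
    intro N
    simp_rw [dist_pi_lt_iff hε, Set.ofPred_forall]
    exact MeasurableSet.iInter fun j => ((r j).stronglyMeasurable.dist
      stronglyMeasurable_const).measurable measurableSet_Iio
  classical
  have hfind : Measurable fun ω => Nat.find (hex ω) := measurable_find hex hmeas
  exact ⟨fun ω => (p (Nat.find (hex ω))).1, fun ω => γ₀ (Nat.find (hex ω)),
    (Measurable.of_discrete (f := fun N => (p N).1)).comp hfind,
    (StronglyMeasurable.of_discrete (f := γ₀)).comp_measurable hfind,
    fun ω => Nat.find_spec (hex ω)⟩

theorem exists_finite_index_net (μ : Measure Ω) [IsProbabilityMeasure μ] (m : ℕ) {δ : ℝ}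
    (hδ : 0 < δ) :
    ∃ T : Set {i : Ω → Fin m // Measurable i}, T.Finite ∧
      ∀ i : {i : Ω → Fin m // Measurable i}, ∃ i' ∈ T,
        ∀ k, |μ.real {ω | i'.1 ω ≤ k} - μ.real {ω | i.1 ω ≤ k}| ≤ δ := by
  let c : {i : Ω → Fin m // Measurable i} → Fin m → ℝ := fun i k => μ.real {ω | i.1 ω ≤ k}
  have hc : TotallyBounded (Set.range c) := by
    refine (isCompact_Icc (a := (0 : Fin m → ℝ)) (b := 1)).totallyBounded.subset ?_
    rintro _ ⟨i, rfl⟩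
    exact ⟨fun k => measureReal_nonneg, fun k => measureReal_le_one⟩
  -- The net is taken inside the range of `c`, so each of its points is realised by an actual
  -- partition.
  obtain ⟨t, htc, ht, hcov⟩ := Metric.finite_approx_of_totallyBounded hc δ hδ
  have : Finite t := ht
  choose f hf using fun x : t => htc x.2
  refine ⟨Set.range f, Set.finite_range f, fun i => ?_⟩
  obtain ⟨x, hx, hix⟩ := Set.mem_iUnion₂.1 (hcov (Set.mem_range_self i))
  refine ⟨f ⟨x, hx⟩, Set.mem_range_self _, fun k => ?_⟩
  have h1 := (dist_le_pi_dist (c i) x k).trans (Metric.mem_ball.1 hix).le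
  rwa [← show c (f ⟨x, hx⟩) = x from hf ⟨x, hx⟩, dist_comm, Real.dist_eq] at h1

variable [TopologicalSpace Ω] [PolishSpace Ω] [BorelSpace Ω]

theorem MeasureWreath.isApproxOligomorphic [NullSingletonClass μ] {G : Type u} [Group G]
    [TopologicalSpace G] [IsTopologicalGroup G] [TopologicalSpace.SeparableSpace G] {X : Type v}
    [MetricSpace X] [BoundedSpace X] [CompleteSpace X] [MulAction G X] [ContinuousSMul G X]
    [IsIsometricSMul G X] (h : IsApproxOligomorphic G X) :
    IsApproxOligomorphic (MeasureWreath μ G) (Ω →ₘ[μ] X) := by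
  rw [isApproxOligomorphic_iff] at h ⊢
  intro n ε hε
  obtain ⟨F, hF, hcov⟩ := h n (ε / 2) (by positivity)
  have : Fintype F := hF.fintype
  let m := Fintype.card F
  let y : Fin m → Fin n → X := fun k => ((Fintype.equivFin F).symm k).1
  have hy : ∀ x : Fin n → X, ∃ (k : Fin m) (g : G), dist x (g • y k) < ε / 2 := by
    intro x
    obtain ⟨z, hz, g, hg⟩ := hcov x
    refine ⟨Fintype.equivFin F ⟨z, hz⟩, g, ?_⟩
    simpa only [y, Equiv.symm_apply_apply] using hg
  let M := Metric.diam (Set.univ : Set X)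
  have hM : 0 ≤ M := Metric.diam_nonneg
  have hdM : ∀ a b : X, dist a b ≤ M := fun a b =>
    Metric.dist_le_diam_of_mem (Bornology.IsBounded.all _) (Set.mem_univ _) (Set.mem_univ _)
  -- The exceptional set will have measure at most `m * δ` and distances on it are at most `M`, a
  -- cost of at most `ε / 4`; the `+ 1` keeps the denominator positive.
  let δ : ℝ := ε / 4 / (M * m + 1)
  have hδ : 0 < δ := by positivity
  have hMδ : M * (m * δ) ≤ ε / 4 := by
    rw [← mul_assoc, mul_div_assoc', div_le_iff₀ (by positivity)]
    nlinarith
  have hsm : ∀ (i : {i : Ω → Fin m // Measurable i}) (j : Fin n),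
      AEStronglyMeasurable (fun ω => y (i.1 ω) j) μ := fun i j =>
    ((StronglyMeasurable.of_discrete (f := fun k => y k j)).comp_measurable
      i.2).aestronglyMeasurable
  let σ : {i : Ω → Fin m // Measurable i} → Fin n → Ω →ₘ[μ] X := fun i j =>
    AEEqFun.mk (fun ω => y (i.1 ω) j) (hsm i j)
  obtain ⟨T, hT, hnet⟩ := exists_finite_index_net μ m hδ
  refine ⟨σ '' T, hT.image _, fun r => ?_⟩
  obtain ⟨i, γ, hi, hγ, hr⟩ := exists_measurable_index (half_pos hε) y hy r
  obtain ⟨i', hi'T, hii'⟩ := hnet ⟨i, hi⟩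
  obtain ⟨t, B, hB, hBδ, ht⟩ := exists_measureAut_index i'.2 hi hii'
  -- In `x = (γ, t)`, the automorphism `t` carries the model partition `i'` to `i` off `B`, and `γ`
  -- then moves `y (i ω)` close to the tuple.
  obtain ⟨x, hx⟩ := (MeasureWreath.bijective_base_top (μ := μ) (G := G)).2
    (AEEqFun.mk γ hγ.aestronglyMeasurable, t)
  have hxb : x.base = AEEqFun.mk γ hγ.aestronglyMeasurable := (Prod.ext_iff.1 hx).1
  have hxt : x.top = t := (Prod.ext_iff.1 hx).2
  refine ⟨_, Set.mem_image_of_mem σ hi'T, x, (dist_pi_lt_iff hε).2 fun j => ?_⟩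
  have hae : ∀ᵐ ω ∂μ, dist (r j ω) ((x • σ i' j) ω) ≤ ε / 2 + B.indicator (fun _ => M) ω := by
    filter_upwards [MeasureWreath.coeFn_smul x (σ i' j), AEEqFun.coeFn_mk γ hγ.aestronglyMeasurable,
      (t⁻¹).1.2.quasiMeasurePreserving.ae (AEEqFun.coeFn_mk _ (hsm i' j)), ht] with ω h1 h2 h3 h4
    by_cases hω : ω ∈ B
    · rw [Set.indicator_of_mem hω]
      exact (hdM _ _).trans (by linarith)
    · rw [Set.indicator_of_notMem hω, add_zero, h1, hxb, h2, hxt]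
      have h5 : σ i' j ((t⁻¹).1.1 ω) = y (i ω) j := h3.trans (by rw [h4 hω])
      rw [h5]
      exact (dist_le_pi_dist (fun j => r j ω) (γ ω • y (i ω)) j).trans (hr ω).le
  have hint : Integrable (B.indicator fun _ => M) μ := (integrable_const M).indicator hB
  calc dist (r j) ((x • σ i') j)
      ≤ ∫ ω, (ε / 2 + B.indicator (fun _ => M) ω) ∂μ :=
        integral_mono_ae (integrable_dist_aeEqFun _ _) ((integrable_const _).add hint) hae
    _ = ε / 2 + μ.real B * M := by
        rw [integral_add (integrable_const _) hint, integral_indicator_const _ hB]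
        simp
    _ ≤ ε / 2 + M * (m * δ) := by
        rw [mul_comm]
        gcongr
    _ < ε := by linarith

end Oligomorphic

/-! ### Roelcke precompactness -/

section Roelcke

/-- The distance between the two points of a pair is `G`-invariant, and every pair is close to a
translate of one of finitely many pairs. -/
theorem IsApproxOligomorphic.boundedSpace {G : Type u} [Group G] {X : Type v} [MetricSpace X]
    [CompleteSpace X] [MulAction G X] [IsIsometricSMul G X] (h : IsApproxOligomorphic G X) :
    BoundedSpace X := by
  obtain ⟨F, hF, hcov⟩ := isApproxOligomorphic_iff.1 h 2 1 one_pos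
  obtain ⟨C, hC⟩ := (hF.image fun p => dist (p 0) (p 1)).bddAbove
  refine ⟨Metric.isBounded_iff.2 ⟨1 + C + 1, fun x _ y _ => ?_⟩⟩
  obtain ⟨p, hp, g, hg⟩ := hcov ![x, y]
  have h0 : dist x (g • p 0) < 1 := (dist_le_pi_dist ![x, y] (g • p) 0).trans_lt hg
  have h1 : dist y (g • p 1) < 1 := (dist_le_pi_dist ![x, y] (g • p) 1).trans_lt hg
  have h2 : dist (p 0) (p 1) ≤ C := hC (Set.mem_image_of_mem _ hp)
  have h3 := dist_triangle4 x (g • p 0) (g • p 1) y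
  rw [dist_smul, dist_comm (g • p 1) y] at h3
  linarith

theorem IsApproxOligomorphic.prod {G : Type u} [Group G] {X : Type v} [MetricSpace X]
    [CompleteSpace X] [MulAction G X] [IsIsometricSMul G X] {Y : Type w} [MetricSpace Y]
    [CompactSpace Y] [MulAction G Y] [IsIsometricSMul G Y] (hY : ∀ (g : G) (y : Y), g • y = y)
    (h : IsApproxOligomorphic G X) : IsApproxOligomorphic G (X × Y) := by
  rw [isApproxOligomorphic_iff] at h ⊢
  intro n ε hε
  obtain ⟨F, hF, hcov⟩ := h n ε hε
  obtain ⟨H, hH, hcovH⟩ := Metric.totallyBounded_iff.1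
    (isCompact_univ (X := Fin n → Y)).totallyBounded ε hε
  refine ⟨Set.image2 (fun a b j => (a j, b j)) F H, hF.image2 _ hH, fun x => ?_⟩
  obtain ⟨a, ha, g, hg⟩ := hcov fun j => (x j).1
  obtain ⟨b, hb, hxb⟩ := Set.mem_iUnion₂.1 (hcovH (Set.mem_univ fun j => (x j).2))
  refine ⟨_, Set.mem_image2_of_mem ha hb, g, (dist_pi_lt_iff hε).2 fun j => ?_⟩
  refine max_lt ((dist_le_pi_dist (fun j => (x j).1) (g • a) j).trans_lt hg) ?_
  refine lt_of_eq_of_lt ?_ ((dist_le_pi_dist (fun j => (x j).2) b j).trans_lt hxb)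
  exact congrArg (dist (x j).2) (hY g (b j))

variable {G : Type u} [Group G] [t : TopologicalSpace G]

theorem IsTopologicallyFaithful.continuousSMul {X : Type v} [MetricSpace X] [MulAction G X]
    [IsIsometricSMul G X] (h : IsTopologicallyFaithful G X) : ContinuousSMul G X := by
  refine ⟨continuous_iff_continuousAt.2 fun p => tendsto_iff_dist_tendsto_zero.2 ?_⟩
  have h1 : Continuous fun q : G × X => dist q.2 p.2 + dist (q.1 • p.2) (p.1 • p.2) := by
    have : Continuous fun g : G => g • p.2 := (continuous_apply p.2).comp h.continuous
    fun_prop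
  refine squeeze_zero (fun _ => dist_nonneg)
    (fun q => (dist_triangle _ (q.1 • p.2) _).trans_eq (by rw [dist_smul])) ?_
  simpa using h1.tendsto p

/-- Isometries are equicontinuous, so convergence on a dense family implies pointwise convergence. A
dense sequence provides the countable family needed by `tendsto_aeEqFun_of_comp`. -/
theorem IsTopologicallyFaithful.isInducing_dense {X : Type v} [MetricSpace X] [MulAction G X]
    [IsIsometricSMul G X] (h : IsTopologicallyFaithful G X) {ι : Type*} {d : ι → X}
    (hd : DenseRange d) : IsInducing fun (g : G) k => g • d k := by
  refine isInducing_iff_nhds.2 fun g => le_antisymm ?_ ?_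
  · rw [← tendsto_iff_comap]
    exact tendsto_pi_nhds.2 fun k => ((continuous_apply (d k)).comp h.continuous).tendsto g
  · have hc := tendsto_pi_nhds.1
      (tendsto_comap (f := fun (g : G) k => g • d k) (x := 𝓝 fun k => g • d k))
    rw [h.isInducing.nhds_eq_comap, ← tendsto_iff_comap]
    refine tendsto_pi_nhds.2 fun x => ?_
    refine Metric.tendsto_nhds.2 fun ε hε => ?_
    obtain ⟨k, hk⟩ := hd.exists_dist_lt x (show 0 < ε / 3 by positivity)
    filter_upwards [Metric.tendsto_nhds.1 (hc k) (ε / 3) (by positivity)] with g' hg'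
    have h1 := dist_triangle4 (g' • x) (g' • d k) (g • d k) (g • x)
    rw [dist_smul, dist_smul, dist_comm (d k) x] at h1
    exact h1.trans_lt (by linarith)

theorem IsRoelckePrecompact.exists_nonempty (h : IsRoelckePrecompact G) :
    ∃ (X : Type) (_ : MetricSpace X) (_ : MulAction G X) (_ : IsIsometricSMul G X),
      Nonempty X ∧ CompleteSpace X ∧ TopologicalSpace.SeparableSpace X ∧
        IsTopologicallyFaithful G X ∧ IsApproxOligomorphic G X := by
  obtain ⟨X, _, _, _, h1, h2, h3, h4⟩ := h
  rcases isEmpty_or_nonempty X with hX | hX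
  -- A faithful action on the empty space forces `G` to be trivial, and a one-point space serves
  -- instead.
  · have hG : Subsingleton G := h3.injective.subsingleton
    have hiso : IsIsometricSMul G Unit := ⟨fun _ => isometry_subsingleton⟩
    refine ⟨Unit, inferInstance, inferInstance, hiso, inferInstance, inferInstance, inferInstance,
      ⟨⟨Subsingleton.elim _ _⟩, Function.injective_of_subsingleton _⟩, ?_⟩
    refine isApproxOligomorphic_iff.2 fun n ε hε => ⟨{fun _ => ()}, Set.finite_singleton _,
      fun x => ⟨_, rfl, 1, ?_⟩⟩
    rwa [Subsingleton.elim x _, dist_self]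
  · exact ⟨X, _, _, _, hX, h1, h2, h3, h4⟩

variable {Ω : Type w} [TopologicalSpace Ω] [PolishSpace Ω] [MeasurableSpace Ω] [BorelSpace Ω]
  {μ : Measure Ω} [IsProbabilityMeasure μ] [IsTopologicalGroup G]

theorem MeasureWreath.comp_smul_const {X : Type v} [TopologicalSpace X] [MulAction G X]
    [ContinuousSMul G X] {Z : Type*} [TopologicalSpace Z] (φ : X → Z) (hφ : Continuous φ)
    (z : MeasureWreath μ G) (p : X) :
    (z • AEEqFun.const Ω p).comp φ hφ =
      z.base.comp (fun g => φ (g • p)) (hφ.comp (continuous_id.smul continuous_const)) := by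
  refine AEEqFun.ext ?_
  filter_upwards [AEEqFun.coeFn_comp φ hφ (z • AEEqFun.const Ω p),
    coeFn_smul z (AEEqFun.const Ω p : Ω →ₘ[μ] X),
    (z.top⁻¹).1.2.quasiMeasurePreserving.ae (AEEqFun.coeFn_const Ω (μ := μ) p),
    AEEqFun.coeFn_comp (fun g => φ (g • p)) (hφ.comp (continuous_id.smul continuous_const)) z.base]
    with ω h1 h2 h3 h4
  rw [h1, h4, Function.comp_apply, Function.comp_apply, h2, h3, Function.const_apply]

theorem MeasureWreath.comp_smul_of_invariant {X : Type v} [TopologicalSpace X] [MulAction G X]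
    [ContinuousSMul G X] {Z : Type*} [TopologicalSpace Z] (φ : X → Z) (hφ : Continuous φ)
    (hinv : ∀ (g : G) (p : X), φ (g • p) = φ p) (z : MeasureWreath μ G) (r : Ω →ₘ[μ] X) :
    (z • r).comp φ hφ = z.top.act (r.comp φ hφ) := by
  refine AEEqFun.ext ?_
  filter_upwards [AEEqFun.coeFn_comp φ hφ (z • r), coeFn_smul z r,
    MeasureAut.coeFn_act z.top (r.comp φ hφ),
    (z.top⁻¹).1.2.quasiMeasurePreserving.ae (AEEqFun.coeFn_comp φ hφ r)] with ω h1 h2 h3 h4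
  rw [h1, h3, h4, Function.comp_apply, Function.comp_apply, h2, hinv]

/-- If `G` acts faithfully on `X` and trivially on the unit interval, then `G ≀ Ω` acts faithfully
on the space of random variables with values in the product. -/
theorem MeasureWreath.isTopologicallyFaithful [PolishSpace G] {X : Type v} [Nonempty X]
    [MetricSpace X] [BoundedSpace X] [TopologicalSpace.SeparableSpace X] [MulAction G X]
    [IsIsometricSMul G X] [ContinuousSMul G X] [MulAction G unitInterval]
    [ContinuousSMul G unitInterval] [IsIsometricSMul G unitInterval]
    (htriv : ∀ (g : G) (y : unitInterval), g • y = y) (h : IsTopologicallyFaithful G X) :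
    IsTopologicallyFaithful (MeasureWreath μ G) (Ω →ₘ[μ] X × unitInterval) := by
  obtain ⟨m, rfl, _, _⟩ := exists_completeSpace_boundedSpace_metric G
  have hind : IsInducing fun (z : MeasureWreath μ G) (r : Ω →ₘ[μ] X × unitInterval) => z • r := by
    refine isInducing_iff_nhds.2 fun z => le_antisymm ?_ ?_
    · rw [← tendsto_iff_comap]
      exact tendsto_pi_nhds.2 fun r => (continuous_id.smul continuous_const).tendsto z
    · have hc := tendsto_pi_nhds.1 (tendsto_comap
        (f := fun (z : MeasureWreath μ G) (r : Ω →ₘ[μ] X × unitInterval) => z • r)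
        (x := 𝓝 fun r => z • r))
      refine (MeasureWreath.tendsto_iff (l := comap _ _) (x := id)).2
        ⟨?_, MeasureAut.tendsto_iff.2 fun r => ?_⟩
      -- `Aut(Ω)` fixes constant variables, so evaluating at the constants `(x, 0)`, with `x` in a
      -- dense sequence, sees only the `G^Ω` component.
      · refine tendsto_aeEqFun_of_comp (fun k g => g • TopologicalSpace.denseSeq X k)
          (fun k => continuous_id.smul continuous_const)
          (h.isInducing_dense (TopologicalSpace.denseRange_denseSeq X)) fun k => ?_
        have h1 := ((continuous_aeEqFun_comp (Prod.fst : X × unitInterval → X)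
          continuous_fst).tendsto _).comp
          (hc (AEEqFun.const Ω (TopologicalSpace.denseSeq X k, 0)))
        simp only [Function.comp_def, MeasureWreath.comp_smul_const] at h1
        exact h1
      -- The second coordinate is `G`-invariant, so it sees only the `Aut(Ω)` component; a fixed
      -- point of `X` fills the first coordinate.
      · have h1 := ((continuous_aeEqFun_comp (Prod.snd : X × unitInterval → unitInterval)
          continuous_snd).tendsto _).comp
          (hc (r.comp (fun y => (Classical.arbitrary X, y)) (by fun_prop)))
        simp only [Function.comp_def, MeasureWreath.comp_smul_of_invariant Prod.snd continuous_snd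
          (fun (g : G) (p : X × unitInterval) => htriv g p.2), AEEqFun.comp_comp] at h1
        simpa only [Function.comp_def, id, ← Function.id_def, AEEqFun.comp_id] using h1
  exact ⟨hind, hind.injective⟩

theorem IsRoelckePrecompact.measureWreath {Ω : Type} [TopologicalSpace Ω] [PolishSpace Ω]
    [MeasurableSpace Ω] [BorelSpace Ω] {μ : Measure Ω} [IsProbabilityMeasure μ]
    [NullSingletonClass μ] [PolishSpace G] (h : IsRoelckePrecompact G) :
    IsRoelckePrecompact (MeasureWreath μ G) := by
  obtain ⟨X, _, _, _, _, _, _, hf, ho⟩ := h.exists_nonempty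
  have := ho.boundedSpace
  have := hf.continuousSMul
  let act : MulAction G unitInterval :=
    { smul := fun _ y => y, one_smul := fun _ => rfl, mul_smul := fun _ _ _ => rfl }
  have htriv : ∀ (g : G) (y : unitInterval), g • y = y := fun _ _ => rfl
  have : ContinuousSMul G unitInterval := ⟨continuous_snd⟩
  have : IsIsometricSMul G unitInterval := ⟨fun _ => isometry_id⟩
  exact ⟨Ω →ₘ[μ] X × unitInterval, inferInstance, inferInstance, inferInstance, inferInstance,
    inferInstance, MeasureWreath.isTopologicallyFaithful htriv hf,
    MeasureWreath.isApproxOligomorphic (ho.prod htriv)⟩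

end Roelcke

theorem mainTheorem2 {Ω : Type} [TopologicalSpace Ω] [PolishSpace Ω] [MeasurableSpace Ω]
    [BorelSpace Ω] (μ : Measure Ω) [IsProbabilityMeasure μ] [NullSingletonClass μ]
    (G : Type u) [Group G] [TopologicalSpace G] [IsTopologicalGroup G] [PolishSpace G] :
    (IsTopologicalGroup (MeasureWreath μ G) ∧ PolishSpace (MeasureWreath μ G)) ∧
    (∀ (X : Type v) [MetricSpace X] [BoundedSpace X] [CompleteSpace X]
        [TopologicalSpace.SeparableSpace X] [MulAction G X] [ContinuousSMul G X]
        [IsIsometricSMul G X],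
      IsApproxOligomorphic G X →
        CompleteSpace (Ω →ₘ[μ] X) ∧ TopologicalSpace.SeparableSpace (Ω →ₘ[μ] X) ∧
        ContinuousSMul (MeasureWreath μ G) (Ω →ₘ[μ] X) ∧
        IsApproxOligomorphic (MeasureWreath μ G) (Ω →ₘ[μ] X)) ∧
    (IsRoelckePrecompact G → IsRoelckePrecompact (MeasureWreath μ G)) :=
  ⟨⟨inferInstance, inferInstance⟩,
    fun _ _ _ _ _ _ _ _ h => ⟨inferInstance, inferInstance, inferInstance,
      MeasureWreath.isApproxOligomorphic h⟩,
    fun h => h.measureWreath⟩
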